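/- Conventions. Let $(M,J,g)$ be a Hermitian manifold of complex dimension $n$, with $\omega=\sqrt{-1}\,g_{i\bar j}\,dz^i\wedge d\bar z^j$ in holomorphic coordinates. Let $\Gamma_{ki}^{j}=g^{j\bar m}\partial_k g_{i\bar m}$ be the Chern connection, $T_{ij}^{k}=\Gamma_{ij}^k-\Gamma_{ji}^k$ its torsion, $T_{ij\bar k}=T_{ij}^l g_{l\bar k}$, and $R_{i\bar jk\bar l}=-(\partial_{\bar j}\Gamma_{ik}^m)\,g_{m\bar l}$ its curvature. Put $$Q_{i\bar jk\bar l}=R_{i\bar jk\bar l}-g^{p\bar q}\,T_{kp\bar j}\,\overline{T_{lq\bar i}} .$$ The metric is *$Q$-nonnegative* if in every orthonormal frame ($g_{i\bar j}=\delta_{ij}$) and for all real $\lambda_1,\dots,\lambda_n$ one has $\sum_{k,m}Q_{m\bar mk\bar k}(\lambda_k^2-\lambda_k\lambda_m)\ge 0$. A Kähler metric has *nonnegative quadratic orthogonal bisectional curvature* if in every orthonormal frame and for all real $\lambda_1,\dots,\lambda_n$ one has $\sum_{k,m}R_{m\bar mk\bar k}(\lambda_m-\lambda_k)^2\ge 0$.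 A compact Hermitian manifold $(M,J,g)$ is *Vaisman* if there is a closed real 1-form $\theta$ with $d\omega=\theta\wedge\omega$ and $\nabla^{LC}\theta=0$, where $\nabla^{LC}$ is the Levi-Civita connection of $g$. A *Kähler cover* of $(M,J,g)$ is a holomorphic covering $\pi:\tilde M\to M$ (a surjective covering map that is a local biholomorphism) together with a Kähler metric $\tilde\omega=e^{f}\pi^*\omega$ on $\tilde M$, where $f:\tilde M\to\mathbb R$. In particular, every Kähler cyclic cover (one whose deck group is infinite cyclic) is such a cover. **Theorem.** 1. Let $(M,J,g)$ be a Vaisman manifold and $\pi:(\tilde M,\tilde\omega)\to M$ a Kähler cover, for example its Kähler cyclic cover. If $\tilde\omega$ has nonnegative quadratic orthogonal bisectional curvature, then $(M,J,g)$ is $Q$-nonnegative. 2. Let $\alpha_1,\dots,\alpha_n\in\mathbb C$ with $0<|\alpha_1|=\cdots=|\alpha_n|<1$, and let $M_\alpha=(\mathbb C^n\setminus\{0\})/\!\sim$ be the diagonal Hopf manifold, where $\sim$ is the equivalence relation generated by $(z_1,\dots,z_n)\sim(\alpha_1z_1,\dots,\alpha_nz_n)$. Then $M_\alpha$ is compact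 and Hausdorff, the form $\dfrac{4\sqrt{-1}\,\partial\bar\partial|z|^2}{|z|^2}$ descends to the fundamental form of a Hermitian metric on $M_\alpha$, and this metric is Vaisman and $Q$-nonnegative. -/

import Mathlib

open scoped Manifold ContDiff Topology ComplexConjugate

noncomputable section

namespace QPositivity

/-- The model space `ℂⁿ`. -/
abbrev Cn (n : ℕ) : Type := EuclideanSpace ℂ (Fin n)

/-! ### Local Hermitian geometry on an open subset of `ℂⁿ`

A Hermitian metric in holomorphic coordinates is a matrix-valued function `G` with
`G z i j = g_{i \bar j}(z)`. -/

/-- The coordinate vector `e_i` of `ℂⁿ`. -/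
def unitVec {n : ℕ} (i : Fin n) : Cn n := EuclideanSpace.single i 1

/-- `∂F/∂zⁱ = ½ (∂F/∂xⁱ - √-1 ∂F/∂yⁱ)`. -/
def dZ {n : ℕ} (i : Fin n) (F : Cn n → ℂ) (z : Cn n) : ℂ :=
  (1 / 2) * (fderiv ℝ F z (unitVec i) - Complex.I * fderiv ℝ F z (Complex.I • unitVec i))

/-- `∂F/∂\bar zⁱ = ½ (∂F/∂xⁱ + √-1 ∂F/∂yⁱ)`. -/
def dZbar {n : ℕ} (i : Fin n) (F : Cn n → ℂ) (z : Cn n) : ℂ :=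
  (1 / 2) * (fderiv ℝ F z (unitVec i) + Complex.I * fderiv ℝ F z (Complex.I • unitVec i))

/-- A matrix-valued function on `ℂⁿ`, to be thought of as `g_{i \bar j}`. -/
abbrev MetricField (n : ℕ) : Type := Cn n → Matrix (Fin n) (Fin n) ℂ

/-- The inverse metric `g^{i \bar j}`, normalised by `∑ₘ g^{i \bar m} g_{k \bar m} = δ_{ik}`. -/
def invMetric {n : ℕ} (G : MetricField n) (z : Cn n) (i j : Fin n) : ℂ := (G z)⁻¹ j i

/-- Chern connection coefficients `Γ_{ki}^j = g^{j \bar m} ∂_k g_{i \bar m}`. -/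
def chernGamma {n : ℕ} (G : MetricField n) (z : Cn n) (k i j : Fin n) : ℂ :=
  ∑ m, invMetric G z j m * dZ k (fun w => G w i m) z

/-- Chern torsion `T_{ij}^k = Γ_{ij}^k - Γ_{ji}^k`. -/
def chernTorsion {n : ℕ} (G : MetricField n) (z : Cn n) (i j k : Fin n) : ℂ :=
  chernGamma G z i j k - chernGamma G z j i k

/-- Chern torsion with lowered index, `T_{ij \bar k} = T_{ij}^l g_{l \bar k}`. -/
def chernTorsionLow {n : ℕ} (G : MetricField n) (z : Cn n) (i j k : Fin n) : ℂ :=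
  ∑ l, chernTorsion G z i j l * G z l k

/-- Chern curvature `R_{i \bar j k \bar l} = R_{i \bar j k}^m g_{m \bar l}`, where
`R_{i \bar j k}^m = - ∂_{\bar j} Γ_{ik}^m`. -/
def chernCurv {n : ℕ} (G : MetricField n) (z : Cn n) (i j k l : Fin n) : ℂ :=
  ∑ m, -dZbar j (fun w => chernGamma G w i k m) z * G z m l

/-- `Q_{i \bar j k \bar l} = R_{i \bar j k \bar l} - g^{p \bar q} T_{kp \bar j} \bar{T_{lq \bar i}}`. -/
def tensorQ {n : ℕ} (G : MetricField n) (z : Cn n) (i j k l : Fin n) : ℂ :=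
  chernCurv G z i j k l -
    ∑ p, ∑ q, invMetric G z p q * chernTorsionLow G z k p j * conj (chernTorsionLow G z l q i)

/-- `A(u, \bar u, v, \bar v)` for a 4-tensor with components `A_{i \bar j k \bar l}`. -/
def evalDiag {n : ℕ} (A : Fin n → Fin n → Fin n → Fin n → ℂ) (u v : Cn n) : ℂ :=
  ∑ i, ∑ j, ∑ k, ∑ l, A i j k l * u i * conj (u j) * v k * conj (v l)

/-- The sesquilinear form `h(u, v) = g_{i \bar j} uⁱ \bar{vʲ}`. -/
def herm {n : ℕ} (G : MetricField n) (z u v : Cn n) : ℂ :=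
  ∑ i, ∑ j, G z i j * u i * conj (v j)

/-- `ε₁, …, εₙ` is an orthonormal frame of `T^{1,0}` at `z`. -/
def IsUnitaryFrame {n : ℕ} (G : MetricField n) (z : Cn n) (ε : Fin n → Cn n) : Prop :=
  ∀ a b, herm G z (ε a) (ε b) = if a = b then 1 else 0

/-! ### Local real geometry

Real tensors are written in the real coordinate frame `∂/∂x¹, …, ∂/∂xⁿ, ∂/∂y¹, …, ∂/∂yⁿ`. -/

/-- The real coordinate frame: `inl i` stands for `∂/∂xⁱ`, `inr i` for `∂/∂yⁱ = J ∂/∂xⁱ`. -/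
def realVec {n : ℕ} : Fin n ⊕ Fin n → Cn n
  | Sum.inl i => unitVec i
  | Sum.inr i => Complex.I • unitVec i

/-- Partial derivative of a real function along a vector of the real coordinate frame. -/
def dR {n : ℕ} (a : Fin n ⊕ Fin n) (F : Cn n → ℝ) (z : Cn n) : ℝ := fderiv ℝ F z (realVec a)

/-- The Riemannian metric `2 Re h`. -/
def riem {n : ℕ} (G : MetricField n) (z : Cn n) : Matrix (Fin n ⊕ Fin n) (Fin n ⊕ Fin n) ℝ :=
  fun a b => 2 * (herm G z (realVec a) (realVec b)).re

/-- The fundamental form `ω = √-1 g_{i \bar j} dzⁱ ∧ d\bar zʲ = -2 Im h`. -/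
def fundForm {n : ℕ} (G : MetricField n) (z : Cn n) (a b : Fin n ⊕ Fin n) : ℝ :=
  -2 * (herm G z (realVec a) (realVec b)).im

/-- Components of `dω`. -/
def dFundForm {n : ℕ} (G : MetricField n) (z : Cn n) (a b c : Fin n ⊕ Fin n) : ℝ :=
  dR a (fun w => fundForm G w b c) z + dR b (fun w => fundForm G w c a) z +
    dR c (fun w => fundForm G w a b) z

/-- Christoffel symbols `Γ_{ab}^c` of the Levi-Civita connection of `2 Re h`. -/
def christoffel {n : ℕ} (G : MetricField n) (z : Cn n) (a b c : Fin n ⊕ Fin n) : ℝ :=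
  (1 / 2) * ∑ d, (riem G z)⁻¹ c d *
    (dR a (fun w => riem G w b d) z + dR b (fun w => riem G w a d) z -
      dR d (fun w => riem G w a b) z)

/-- The real components of a 1-form in coordinates. -/
abbrev CovectorField (n : ℕ) : Type := Cn n → Fin n ⊕ Fin n → ℝ

/-- Components of `dθ`. -/
def dCovector {n : ℕ} (θ : CovectorField n) (z : Cn n) (a b : Fin n ⊕ Fin n) : ℝ :=
  dR a (fun w => θ w b) z - dR b (fun w => θ w a) z

/-- Components of `θ ∧ ω`. -/
def wedgeFund {n : ℕ} (θ : CovectorField n) (G : MetricField n) (z : Cn n)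
    (a b c : Fin n ⊕ Fin n) : ℝ :=
  θ z a * fundForm G z b c + θ z b * fundForm G z c a + θ z c * fundForm G z a b

/-- Components `(∇_a θ)_b = ∂_a θ_b - Γ_{ab}^c θ_c` of the Levi-Civita derivative of `θ`. -/
def nablaCovector {n : ℕ} (G : MetricField n) (θ : CovectorField n) (z : Cn n)
    (a b : Fin n ⊕ Fin n) : ℝ :=
  dR a (fun w => θ w b) z - ∑ c, christoffel G z a b c * θ z c

/-! ### Hermitian metrics and 1-forms on complex manifolds -/

/-- The holomorphic coordinate systems of a complex manifold of dimension `n`. -/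
abbrev holoCharts (n : ℕ) (M : Type*) [TopologicalSpace M] [ChartedSpace (Cn n) M] :
    Set (OpenPartialHomeomorph M (Cn n)) :=
  IsManifold.maximalAtlas 𝓘(ℂ, Cn n) ω M

/-- The tangent vector at `e.symm z` which has coordinates `v` in the chart `e`. -/
def tangentOf {n : ℕ} {M : Type*} [TopologicalSpace M] [ChartedSpace (Cn n) M]
    (e : OpenPartialHomeomorph M (Cn n)) (z v : Cn n) : TangentSpace 𝓘(ℂ, Cn n) (e.symm z) :=
  mfderiv 𝓘(ℂ, Cn n) 𝓘(ℂ, Cn n) e.symm z v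

/-- A smooth Hermitian metric on a complex manifold: smoothly varying positive definite
Hermitian forms (linear in the first slot, conjugate-linear in the second) on the tangent spaces. -/
structure HermitianMetric (n : ℕ) (M : Type*) [TopologicalSpace M] [ChartedSpace (Cn n) M] where
  form : ∀ x : M, TangentSpace 𝓘(ℂ, Cn n) x →ₗ[ℂ] TangentSpace 𝓘(ℂ, Cn n) x →ₗ⋆[ℂ] ℂ
  conj_symm : ∀ x u v, conj (form x u v) = form x v u
  pos : ∀ x u, u ≠ 0 → 0 < (form x u u).re
  smooth : ∀ e ∈ holoCharts n M, ∀ i j : Fin n,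
    ContDiffOn ℝ ∞
      (fun z => form (e.symm z) (tangentOf e z (unitVec i)) (tangentOf e z (unitVec j))) e.target

/-- The components `g_{i \bar j}` of a Hermitian metric in the chart `e`. -/
def HermitianMetric.coord {n : ℕ} {M : Type*} [TopologicalSpace M] [ChartedSpace (Cn n) M]
    (g : HermitianMetric n M) (e : OpenPartialHomeomorph M (Cn n)) : MetricField n :=
  fun z i j => g.form (e.symm z) (tangentOf e z (unitVec i)) (tangentOf e z (unitVec j))

/-- A smooth real 1-form on a complex manifold. -/
structure RealOneForm (n : ℕ) (M : Type*) [TopologicalSpace M] [ChartedSpace (Cn n) M] where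
  form : ∀ x : M, TangentSpace 𝓘(ℂ, Cn n) x →ₗ[ℝ] ℝ
  smooth : ∀ e ∈ holoCharts n M, ∀ a : Fin n ⊕ Fin n,
    ContDiffOn ℝ ∞ (fun z => form (e.symm z) (tangentOf e z (realVec a))) e.target

/-- The real components of a 1-form in the chart `e`. -/
def RealOneForm.coord {n : ℕ} {M : Type*} [TopologicalSpace M] [ChartedSpace (Cn n) M]
    (θ : RealOneForm n M) (e : OpenPartialHomeomorph M (Cn n)) : CovectorField n :=
  fun z a => θ.form (e.symm z) (tangentOf e z (realVec a))

section Manifold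

variable {n : ℕ} {M : Type*} [TopologicalSpace M] [ChartedSpace (Cn n) M]

/-- `dω = 0`. -/
def IsKahler (g : HermitianMetric n M) : Prop :=
  ∀ e ∈ holoCharts n M, ∀ z ∈ e.target, ∀ a b c, dFundForm (g.coord e) z a b c = 0

/-- `θ` is closed and `dω = θ ∧ ω`. -/
def IsLeeForm (g : HermitianMetric n M) (θ : RealOneForm n M) : Prop :=
  ∀ e ∈ holoCharts n M, ∀ z ∈ e.target,
    (∀ a b, dCovector (θ.coord e) z a b = 0) ∧
    ∀ a b c, dFundForm (g.coord e) z a b c = wedgeFund (θ.coord e) (g.coord e) z a b c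

/-- `∇^{LC} θ = 0`. -/
def IsParallel (g : HermitianMetric n M) (θ : RealOneForm n M) : Prop :=
  ∀ e ∈ holoCharts n M, ∀ z ∈ e.target, ∀ a b, nablaCovector (g.coord e) (θ.coord e) z a b = 0

/-- A Vaisman metric: locally conformally Kähler with parallel Lee form. -/
def IsVaisman (g : HermitianMetric n M) : Prop :=
  ∃ θ : RealOneForm n M, IsLeeForm g θ ∧ IsParallel g θ

/-- `Q`-nonnegativity: `∑_{k,m} Q_{m \bar m k \bar k} (λ_k² - λ_k λ_m) ≥ 0` in every orthonormal
frame, for all real `λ`. -/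
def QNonneg (g : HermitianMetric n M) : Prop :=
  ∀ e ∈ holoCharts n M, ∀ z ∈ e.target, ∀ ε : Fin n → Cn n, IsUnitaryFrame (g.coord e) z ε →
    ∀ lam : Fin n → ℝ,
      0 ≤ ∑ k, ∑ m, (evalDiag (tensorQ (g.coord e) z) (ε m) (ε k)).re *
        (lam k ^ 2 - lam k * lam m)

/-- Nonnegative quadratic orthogonal bisectional curvature (for a Kähler metric):
`∑_{k,m} R_{m \bar m k \bar k} (λ_m - λ_k)² ≥ 0` in every orthonormal frame, for all real `λ`. -/
def NonnegQuadOrthBisectional (g : HermitianMetric n M) : Prop :=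
  ∀ e ∈ holoCharts n M, ∀ z ∈ e.target, ∀ ε : Fin n → Cn n, IsUnitaryFrame (g.coord e) z ε →
    ∀ lam : Fin n → ℝ,
      0 ≤ ∑ k, ∑ m, (evalDiag (chernCurv (g.coord e) z) (ε m) (ε k)).re *
        (lam m - lam k) ^ 2

/-- `π : N → M` is a holomorphic covering and `g'` is a Kähler metric on `N` which is conformal to
the pull-back of `g`. No condition on the group of deck transformations is imposed, so this
contains the Kähler cyclic covers. -/
structure IsKahlerCover {N : Type*} [TopologicalSpace N] [ChartedSpace (Cn n) N]
    (π : N → M) (g : HermitianMetric n M) (g' : HermitianMetric n N) : Prop where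
  covering : IsCoveringMap π
  surjective : Function.Surjective π
  holomorphic : IsLocalDiffeomorph 𝓘(ℂ, Cn n) 𝓘(ℂ, Cn n) ω π
  kahler : IsKahler g'
  conformal : ∃ f : N → ℝ, ∀ (x : N) (u v : TangentSpace 𝓘(ℂ, Cn n) x),
    g'.form x u v = (Real.exp (f x) : ℂ) *
      g.form (π x) (mfderiv 𝓘(ℂ, Cn n) 𝓘(ℂ, Cn n) π x u) (mfderiv 𝓘(ℂ, Cn n) 𝓘(ℂ, Cn n) π x v)

end Manifold

/-! ### Diagonal Hopf manifolds -/

/-- Multipliers `α₁, …, αₙ` with `0 < |α₁| = ⋯ = |αₙ| < 1`. -/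
structure HopfMultipliers (n : ℕ) where
  val : Fin n → ℂ
  ne_zero : ∀ i, val i ≠ 0
  norm_lt_one : ∀ i, ‖val i‖ < 1
  norm_eq : ∀ i j, ‖val i‖ = ‖val j‖

/-- `ℂⁿ ∖ {0}`, as an open subset of `ℂⁿ`. -/
abbrev punctured (n : ℕ) : TopologicalSpace.Opens (Cn n) := ⟨{0}ᶜ, isOpen_compl_singleton⟩

/-- `αᵏ z = (α₁ᵏ z₁, …, αₙᵏ zₙ)` for `k : ℤ`. -/
def scale {n : ℕ} (α : HopfMultipliers n) (k : ℤ) (z : Cn n) : Cn n :=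
  WithLp.toLp 2 fun i => α.val i ^ k * z i

/-- The equivalence relation generated by `z ∼ (α₁ z₁, …, αₙ zₙ)` on `ℂⁿ ∖ {0}`. -/
def hopfSetoid {n : ℕ} (α : HopfMultipliers n) : Setoid (punctured n) where
  r z w := ∃ k : ℤ, (w : Cn n) = scale α k z
  iseqv :=
    { refl := fun z => ⟨0, by ext i; simp [scale]⟩
      symm := by
        rintro z w ⟨k, hk⟩
        refine ⟨-k, ?_⟩
        rw [hk]
        ext i
        have := zpow_ne_zero k (α.ne_zero i)
        simp [scale, this]
      trans := by
        rintro x y z ⟨k, hk⟩ ⟨l, hl⟩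
        refine ⟨l + k, ?_⟩
        rw [hl, hk]
        ext i
        simp [scale, zpow_add₀ (α.ne_zero i), mul_assoc] }

/-- The diagonal Hopf manifold `(ℂⁿ ∖ {0}) / ∼`. -/
def Hopf {n : ℕ} (α : HopfMultipliers n) : Type := Quotient (hopfSetoid α)

instance {n : ℕ} (α : HopfMultipliers n) : TopologicalSpace (Hopf α) :=
  inferInstanceAs (TopologicalSpace (Quotient (hopfSetoid α)))

/-- The projection `ℂⁿ ∖ {0} → Hopf α`. -/
def hopfProj {n : ℕ} (α : HopfMultipliers n) (z : punctured n) : Hopf α :=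
  Quotient.mk (hopfSetoid α) z

section HopfCharts

variable {n : ℕ} (α : HopfMultipliers n)

theorem hopfProj_surjective : Function.Surjective (hopfProj α) := Quotient.mk_surjective

theorem hopfProj_continuous : Continuous (hopfProj α) := continuous_quotient_mk'

theorem hopfProj_eq_iff (z w : punctured n) :
    hopfProj α z = hopfProj α w ↔ ∃ k : ℤ, (w : Cn n) = scale α k z :=
  Quotient.eq (r := hopfSetoid α)

theorem scale_ne_zero (k : ℤ) {z : Cn n} (hz : z ≠ 0) : scale α k z ≠ 0 := by
  intro h
  apply hz
  ext i
  have h' := congrArg (fun v : Cn n => v i) h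
  simpa [scale, zpow_ne_zero k (α.ne_zero i)] using h'

theorem scale_contDiff (k : ℤ) : ContDiff ℂ ω (scale α k) := by
  unfold scale
  fun_prop

theorem norm_scale (i : Fin n) (k : ℤ) (z : Cn n) : ‖scale α k z‖ = ‖α.val i‖ ^ k * ‖z‖ := by
  have h : 0 ≤ ‖α.val i‖ ^ k := by positivity
  rw [← sq_eq_sq₀ (norm_nonneg _) (by positivity), mul_pow, EuclideanSpace.norm_sq_eq,
    EuclideanSpace.norm_sq_eq, Finset.mul_sum]
  refine Finset.sum_congr rfl fun j _ => ?_
  simp [scale, mul_pow, α.norm_eq j i]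

theorem hopfProj_isOpenMap : IsOpenMap (hopfProj α) := by
  intro U hU
  have hq : Topology.IsQuotientMap (hopfProj α) := isQuotientMap_quotient_mk'
  rw [← hq.isOpen_preimage]
  have : hopfProj α ⁻¹' (hopfProj α '' U) =
      ⋃ k : ℤ, (fun z : punctured n =>
        (⟨scale α k z, scale_ne_zero α k z.2⟩ : punctured n)) ⁻¹' U := by
    ext z
    simp only [Set.mem_preimage, Set.mem_image, Set.mem_iUnion]
    constructor
    · rintro ⟨w, hw, hwz⟩
      obtain ⟨k, hk⟩ := (hopfProj_eq_iff α z w).1 hwz.symm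
      refine ⟨k, ?_⟩
      have : (⟨scale α k z, scale_ne_zero α k z.2⟩ : punctured n) = w := Subtype.ext hk.symm
      rwa [this]
    · rintro ⟨k, hk⟩
      exact ⟨_, hk, ((hopfProj_eq_iff α z _).2 ⟨k, rfl⟩).symm⟩
  rw [this]
  refine isOpen_iUnion fun k => hU.preimage ?_
  exact ((scale_contDiff α k).continuous.comp continuous_subtype_val).subtype_mk _

theorem hopfProj_isLocalHomeomorph : IsLocalHomeomorph (hopfProj α) := by
  rw [isLocalHomeomorph_iff_isOpenEmbedding_restrict]
  intro z
  have hz : (z : Cn n) ≠ 0 := z.2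
  obtain ⟨i, -⟩ : ∃ i, (z : Cn n) i ≠ 0 := by
    by_contra! h
    exact hz (by ext i; simpa using h i)
  set ρ := ‖α.val i‖ with hρ
  have hρ0 : 0 < ρ := norm_pos_iff.2 (α.ne_zero i)
  have hρ1 : ρ < 1 := α.norm_lt_one i
  have hz0 : 0 < ‖(z : Cn n)‖ := norm_pos_iff.2 hz
  let A : Set (punctured n) :=
    {w | ρ * ‖(z : Cn n)‖ ^ 2 < ‖(w : Cn n)‖ ^ 2 ∧ ρ * ‖(w : Cn n)‖ ^ 2 < ‖(z : Cn n)‖ ^ 2}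
  have hA : IsOpen A := by
    have hc : Continuous fun w : punctured n => ‖(w : Cn n)‖ ^ 2 := by fun_prop
    exact (isOpen_lt continuous_const hc).inter
      (isOpen_lt (continuous_const.mul hc) continuous_const)
  refine ⟨A, hA.mem_nhds ⟨by nlinarith [pow_pos hz0 2], by nlinarith [pow_pos hz0 2]⟩, ?_⟩
  refine .of_continuous_injective_isOpenMap ((hopfProj_continuous α).comp continuous_subtype_val)
    ?_ ((hopfProj_isOpenMap α).domRestrict hA)
  -- no nontrivial power of the contraction maps a point of the annulus into the annulus
  have key : ∀ (x y : A) (k : ℤ), 0 < k → (y.1 : Cn n) ≠ scale α k x.1 := by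
    intro x y k hk h
    have h1 : ‖(y.1 : Cn n)‖ = ρ ^ k * ‖(x.1 : Cn n)‖ := by rw [h, norm_scale α i]
    have h2 : ρ ^ k ≤ ρ := by
      simpa using zpow_le_zpow_right_of_le_one₀ hρ0 hρ1.le (show (1 : ℤ) ≤ k by omega)
    have h3 : ‖(y.1 : Cn n)‖ ≤ ρ * ‖(x.1 : Cn n)‖ := by
      rw [h1]; exact mul_le_mul_of_nonneg_right h2 (norm_nonneg _)
    have h4 : ‖(y.1 : Cn n)‖ ^ 2 ≤ ρ * (ρ * ‖(x.1 : Cn n)‖ ^ 2) := by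
      calc _ ≤ (ρ * ‖(x.1 : Cn n)‖) ^ 2 := by gcongr
        _ = _ := by ring
    have h5 := x.2.2
    have h6 := y.2.1
    nlinarith
  intro x y hxy
  obtain ⟨k, hk⟩ := (hopfProj_eq_iff α x.1 y.1).1 hxy
  obtain ⟨l, hl⟩ := (hopfProj_eq_iff α y.1 x.1).1 hxy.symm
  rcases lt_trichotomy k 0 with h | h | h
  · exfalso
    refine key y x (-k) (by omega) ?_
    rw [hk]
    ext j
    simp [scale, zpow_ne_zero k (α.ne_zero j)]
  · subst h
    apply Subtype.ext
    apply Subtype.ext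
    rw [hk]
    ext j
    simp [scale]
  · exact absurd hk (key x y k h)

/-- The charts of the Hopf manifold are the local inverses of the projection. -/
instance : ChartedSpace (Cn n) (Hopf α) :=
  (hopfProj_isLocalHomeomorph α).chartedSpace (hopfProj_surjective α)

theorem hopf_chart_symm {e : OpenPartialHomeomorph (Hopf α) (Cn n)}
    (he : e ∈ atlas (Cn n) (Hopf α)) {w : Cn n} (hw : w ∈ e.target) :
    ∃ h : w ∈ punctured n, e.symm w = hopfProj α ⟨w, h⟩ := by
  obtain ⟨q, rfl⟩ := he
  generalize (hopfProj_surjective α).hasRightInverse.choose q = x at hw ⊢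
  have hw' : w ∈ (chartAt (Cn n) x).target := by
    rw [OpenPartialHomeomorph.trans_target] at hw
    exact hw.1
  have h1 : (((chartAt (Cn n) x).symm w : punctured n) : Cn n) = w :=
    (chartAt (Cn n) x).right_inv hw'
  have h : w ∈ punctured n := h1 ▸ ((chartAt (Cn n) x).symm w).2
  refine ⟨h, ?_⟩
  have h2 : (chartAt (Cn n) x).symm w = (⟨w, h⟩ : punctured n) := Subtype.ext h1
  rw [OpenPartialHomeomorph.trans_symm_eq_symm_trans_symm, OpenPartialHomeomorph.trans_apply, h2,
    IsLocalHomeomorph.localInverseAt_symm]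

instance : IsManifold 𝓘(ℂ, Cn n) ω (Hopf α) := by
  apply isManifold_of_contDiffOn
  intro e e' he he' w₀ hw₀
  have hw₀' : w₀ ∈ (e.symm ≫ₕ e').source := hw₀.1
  rw [OpenPartialHomeomorph.trans_source] at hw₀'
  obtain ⟨hs, ht⟩ := hw₀'
  have hs : w₀ ∈ e.target := hs
  have ht : e.symm w₀ ∈ e'.source := ht
  obtain ⟨h0, h1⟩ := hopf_chart_symm α he hs
  obtain ⟨h2, h3⟩ := hopf_chart_symm α he' (e'.map_source ht)
  have h3 := h1.symm.trans ((e'.left_inv ht).symm.trans h3)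
  obtain ⟨k, hk⟩ := (hopfProj_eq_iff α _ _).1 h3
  have hk : e' (e.symm w₀) = scale α k w₀ := hk
  refine ContDiffAt.contDiffWithinAt ?_
  refine (scale_contDiff α k).contDiffAt.congr_of_eventuallyEq ?_
  have hn : ∀ᶠ w in 𝓝 w₀, w ∈ e.target := e.open_target.mem_nhds hs
  have hn' : ∀ᶠ w in 𝓝 w₀, scale α k w ∈ e'.target :=
    (scale_contDiff α k).continuous.continuousAt.eventually_mem
      (e'.open_target.mem_nhds (hk ▸ e'.map_source ht))
  filter_upwards [hn, hn'] with w hw hw'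
  obtain ⟨a, ha⟩ := hopf_chart_symm α he hw
  obtain ⟨b, hb⟩ := hopf_chart_symm α he' hw'
  have hab : e.symm w = e'.symm (scale α k w) := by
    rw [ha, hb]
    exact (hopfProj_eq_iff α _ _).2 ⟨k, rfl⟩
  change e' (e.symm w) = scale α k w
  rw [hab, e'.right_inv hw']

end HopfCharts

end QPositivity

end

open QPositivity

/-! Write h for the Hermitian form, so that the Riemannian metric is 2 Re h and ω = -2 Im h. Locally
on a Kähler cover, the Kähler metric is G' = e^F G with G the given metric. Closedness of e^F ω
gives dω = -dF ∧ ω, and for n ≥ 2 the Lee form is determined by this equation, so θ = -dF. For n ≤ 1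
every summand of the Q-condition has k = m and vanishes.

Let X be the vector with 2 Re h(X, ·) = θ. Three computations combine. (a) The (2,1)-part of dω = θ
∧ ω gives the torsion T_{kp\bar j} = h(e_k, X) g_{p\bar j} - h(e_p, X) g_{k\bar j}. Hence
Q(u,ū,v,v̄) = R(u,ū,v,v̄) - |h(v,X)|² h(u,u) whenever h(v,u) = 0 (`evalDiag_tensorQ`). (b) The
curvature changes by R' = e^F (R - ∂∂̄F ⊗ g) (`chernCurv_conformal`). (c) If θ is parallel, then
∂∂̄F(u,ū) = h(X,X) h(u,u) - |h(u,X)|² (`complexHessian_of_parallel`).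

In a unitary frame, with S = h(X,X) and a_k = |h(ε_k,X)|², this yields for k ≠ m Q_{m\bar mk\bar k}
= e^{-F} R'_{m\bar mk\bar k} + (S - a_m - a_k). Diagonal entries do not matter, since they carry
λ_k² - λ_kλ_k = 0. Both terms on the right are symmetric in k and m (the first because G' is
Kähler), so the weight λ_k² - λ_kλ_m may be replaced by ½(λ_m - λ_k)². The first sum is then
nonnegative by the assumption on R', and the second because S - a_m - a_k ≥ 0 is Bessel's inequality
for X. This is `tensorQ_sum_nonneg`.

The argument is local, so on the Hopf manifold it is applied directly to the flat metric, pulled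
back by a local lift φ of a chart to ℂⁿ ∖ {0}, with F = log(|φ|²/4). Here R' = 0, and X is -1/4
times the Euler field. That -dF is parallel is a direct computation with this X
(`CoordChangeAt.parallelAt`). Equality of the moduli |α_i| makes the metric and the Lee form
invariant under the identifications (`hopfForm_lift`, `hopfLeeForm_lift`). -/

namespace QPositivity

/-! ### Sesquilinear forms attached to matrices -/

/-- The sesquilinear form `(u, v) ↦ ∑ A_{i \bar j} uⁱ \bar{vʲ}` of a matrix. -/
noncomputable def sesq {n : ℕ} (A : Matrix (Fin n) (Fin n) ℂ) : Cn n →ₗ[ℂ] Cn n →ₗ⋆[ℂ] ℂ :=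
  LinearMap.mk₂'ₛₗ (RingHom.id ℂ) (starRingEnd ℂ) (fun u v => ∑ i, ∑ j, A i j * u i * conj (v j))
    (fun u u' v => by
      simp only [PiLp.add_apply, mul_add, add_mul, Finset.sum_add_distrib])
    (fun c u v => by
      simp only [PiLp.smul_apply, smul_eq_mul, Finset.mul_sum, RingHom.id_apply]
      refine Finset.sum_congr rfl fun i _ => Finset.sum_congr rfl fun j _ => by ring)
    (fun u v v' => by
      simp only [PiLp.add_apply, map_add, mul_add, Finset.sum_add_distrib])
    (fun c u v => by
      simp only [PiLp.smul_apply, smul_eq_mul, map_mul, Finset.mul_sum]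
      refine Finset.sum_congr rfl fun i _ => Finset.sum_congr rfl fun j _ => by ring)

theorem sesq_apply {n : ℕ} (A : Matrix (Fin n) (Fin n) ℂ) (u v : Cn n) :
    sesq A u v = ∑ i, ∑ j, A i j * u i * conj (v j) := rfl

theorem herm_eq_sesq {n : ℕ} (G : MetricField n) (z u v : Cn n) :
    herm G z u v = sesq (G z) u v := rfl

theorem sum_smul_unitVec {n : ℕ} (u : Cn n) : ∑ i, u i • unitVec i = u := by
  ext j
  simp [unitVec, Pi.single_apply]

theorem unitVec_apply {n : ℕ} (i j : Fin n) : (unitVec i : Cn n) j = if j = i then 1 else 0 := by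
  simp [unitVec]

theorem sesq_unitVec {n : ℕ} (A : Matrix (Fin n) (Fin n) ℂ) (i j : Fin n) :
    sesq A (unitVec i) (unitVec j) = A i j := by
  simp [sesq_apply, unitVec_apply]

theorem sesq_unitVec_left {n : ℕ} (A : Matrix (Fin n) (Fin n) ℂ) (i : Fin n) (v : Cn n) :
    sesq A (unitVec i) v = ∑ j, A i j * conj (v j) := by
  simp [sesq_apply, unitVec_apply]

theorem sesq_conj {n : ℕ} {A : Matrix (Fin n) (Fin n) ℂ} (hA : ∀ i j, conj (A i j) = A j i)
    (u v : Cn n) : conj (sesq A u v) = sesq A v u := by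
  simp only [sesq_apply, map_sum, map_mul, hA, Complex.conj_conj]
  rw [Finset.sum_comm]
  refine Finset.sum_congr rfl fun i _ => Finset.sum_congr rfl fun j _ => by ring

theorem sesq_re_comm {n : ℕ} {A : Matrix (Fin n) (Fin n) ℂ} (hA : ∀ i j, conj (A i j) = A j i)
    (u v : Cn n) : (sesq A u v).re = (sesq A v u).re := by
  rw [← sesq_conj hA, Complex.conj_re]

theorem sesq_im_comm {n : ℕ} {A : Matrix (Fin n) (Fin n) ℂ} (hA : ∀ i j, conj (A i j) = A j i)
    (u v : Cn n) : (sesq A u v).im = -(sesq A v u).im := by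
  rw [← sesq_conj hA, Complex.conj_im]

theorem sesq_self_im {n : ℕ} {A : Matrix (Fin n) (Fin n) ℂ} (hA : ∀ i j, conj (A i j) = A j i)
    (u : Cn n) : (sesq A u u).im = 0 := by
  have := sesq_im_comm hA u u
  linarith

theorem sesq_real_smul_left {n : ℕ} (A : Matrix (Fin n) (Fin n) ℂ) (r : ℝ) (u v : Cn n) :
    sesq A (r • u) v = r * sesq A u v := by
  rw [← Complex.coe_smul, map_smul]; rfl

theorem sesq_real_smul_right {n : ℕ} (A : Matrix (Fin n) (Fin n) ℂ) (r : ℝ) (u v : Cn n) :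
    sesq A u (r • v) = r * sesq A u v := by
  rw [← Complex.coe_smul, map_smulₛₗ]; simp

theorem sesq_I_left {n : ℕ} (A : Matrix (Fin n) (Fin n) ℂ) (u v : Cn n) :
    sesq A (Complex.I • u) v = Complex.I * sesq A u v := by
  rw [map_smul]; rfl

theorem sesq_I_right {n : ℕ} (A : Matrix (Fin n) (Fin n) ℂ) (u v : Cn n) :
    sesq A u (Complex.I • v) = -Complex.I * sesq A u v := by
  rw [map_smulₛₗ]; simp

/-! ### The real coordinate frame -/

/-- Real coordinates of a vector of `ℂⁿ`. -/
noncomputable def realCoord {n : ℕ} (u : Cn n) : Fin n ⊕ Fin n → ℝ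
  | Sum.inl i => (u i).re
  | Sum.inr i => (u i).im

theorem sum_realCoord_smul {n : ℕ} (u : Cn n) : ∑ a, realCoord u a • realVec a = u := by
  ext j
  simp [realCoord, realVec, unitVec_apply, Fintype.sum_sum_type, Complex.re_add_im]

theorem realCoord_sum {n : ℕ} (x : Fin n ⊕ Fin n → ℝ) :
    realCoord (∑ a, x a • realVec a : Cn n) = x := by
  ext a
  rcases a with i | i <;>
  simp [realCoord, realVec, unitVec_apply, Fintype.sum_sum_type, apply_ite]

/-- The manifold-level conditions are stated on the coordinate frame. This principle extends
identities that are real linear in a slot to arbitrary vectors. -/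
theorem realVec_induction {n : ℕ} {p : Cn n → Prop} (h : ∀ a, p (realVec a))
    (hadd : ∀ u v, p u → p v → p (u + v)) (hsmul : ∀ (r : ℝ) u, p u → p (r • u)) (h0 : p 0)
    (u : Cn n) : p u := by
  rw [← sum_realCoord_smul u]
  exact Finset.sum_induction _ p (fun a b => hadd a b) h0 fun a _ => hsmul _ _ (h a)

/-! ### First derivatives of the metric -/

/-- The derivative of a matrix-valued function along the vector `d`. -/
noncomputable def dMat {n : ℕ} (G : MetricField n) (z : Cn n) (d : Cn n) :
    Matrix (Fin n) (Fin n) ℂ :=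
  fun i j => fderiv ℝ (fun w => G w i j) z d

theorem sesq_dMat_add {n : ℕ} (G : MetricField n) (z d d' u v : Cn n) :
    sesq (dMat G z (d + d')) u v = sesq (dMat G z d) u v + sesq (dMat G z d') u v := by
  simp [sesq_apply, dMat, add_mul, Finset.sum_add_distrib]

theorem sesq_dMat_smul {n : ℕ} (G : MetricField n) (z d u v : Cn n) (r : ℝ) :
    sesq (dMat G z (r • d)) u v = r * sesq (dMat G z d) u v := by
  simp [sesq_apply, dMat, Finset.mul_sum, mul_assoc]

theorem sesq_dMat_zero {n : ℕ} (G : MetricField n) (z u v : Cn n) :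
    sesq (dMat G z 0) u v = 0 := by
  simp [sesq_apply, dMat]

theorem differentiableAt_herm {n : ℕ} {G : MetricField n} {z : Cn n}
    (hG : ∀ i j, DifferentiableAt ℝ (fun w => G w i j) z) (u v : Cn n) :
    DifferentiableAt ℝ (fun w => herm G w u v) z :=
  DifferentiableAt.fun_sum fun i _ => DifferentiableAt.fun_sum fun j _ =>
    ((hG i j).mul_const _).mul_const _

theorem fderiv_herm {n : ℕ} {G : MetricField n} {z : Cn n}
    (hG : ∀ i j, DifferentiableAt ℝ (fun w => G w i j) z) (u v d : Cn n) :
    fderiv ℝ (fun w => herm G w u v) z d = sesq (dMat G z d) u v := by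
  have h : ∀ i j, DifferentiableAt ℝ (fun w => G w i j * u i * conj (v j)) z := fun i j =>
    ((hG i j).mul_const _).mul_const _
  simp only [herm]
  rw [fderiv_fun_sum fun i _ => DifferentiableAt.fun_sum fun j _ => h i j,
    sum_apply, sesq_apply]
  refine Finset.sum_congr rfl fun i _ => ?_
  rw [fderiv_fun_sum fun j _ => h i j, sum_apply]
  refine Finset.sum_congr rfl fun j _ => ?_
  rw [fderiv_mul_const ((hG i j).mul_const _), fderiv_mul_const (hG i j)]
  simp [dMat]
  ring

theorem fderiv_conj {n : ℕ} (f : Cn n → ℂ) (z d : Cn n) :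
    fderiv ℝ (fun w => conj (f w)) z d = conj (fderiv ℝ f z d) := by
  have := Complex.conjCLE.comp_fderiv (f := f) (x := z)
  exact congrArg (fun L : Cn n →L[ℝ] ℂ => L d) this

theorem dMat_conj {n : ℕ} {G : MetricField n} {z : Cn n}
    (hG : ∀ᶠ w in 𝓝 z, ∀ i j, conj (G w i j) = G w j i) (d : Cn n) (i j : Fin n) :
    conj (dMat G z d i j) = dMat G z d j i := by
  rw [dMat, dMat, ← fderiv_conj]
  congr 1
  exact Filter.EventuallyEq.fderiv_eq (hG.mono fun w hw => hw i j)

theorem fderiv_re {n : ℕ} {f : Cn n → ℂ} {z : Cn n} (hf : DifferentiableAt ℝ f z) (d : Cn n) :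
    fderiv ℝ (fun w => (f w).re) z d = (fderiv ℝ f z d).re := by
  have := (Complex.reCLM.hasFDerivAt.comp z hf.hasFDerivAt).fderiv
  exact congrArg (fun L : Cn n →L[ℝ] ℝ => L d) this

theorem fderiv_im {n : ℕ} {f : Cn n → ℂ} {z : Cn n} (hf : DifferentiableAt ℝ f z) (d : Cn n) :
    fderiv ℝ (fun w => (f w).im) z d = (fderiv ℝ f z d).im := by
  have := (Complex.imCLM.hasFDerivAt.comp z hf.hasFDerivAt).fderiv
  exact congrArg (fun L : Cn n →L[ℝ] ℝ => L d) this

theorem dR_fundForm {n : ℕ} {G : MetricField n} {z : Cn n}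
    (hG : ∀ i j, DifferentiableAt ℝ (fun w => G w i j) z) (a b c : Fin n ⊕ Fin n) :
    dR a (fun w => fundForm G w b c) z =
      -2 * (sesq (dMat G z (realVec a)) (realVec b) (realVec c)).im := by
  have hd : DifferentiableAt ℝ (fun w => (herm G w (realVec b) (realVec c)).im) z :=
    Complex.imCLM.differentiableAt.comp z (differentiableAt_herm hG _ _)
  simp only [dR, fundForm]
  rw [fderiv_const_mul hd, smul_apply, fderiv_im (differentiableAt_herm hG _ _), fderiv_herm hG]
  rfl

theorem dR_riem {n : ℕ} {G : MetricField n} {z : Cn n}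
    (hG : ∀ i j, DifferentiableAt ℝ (fun w => G w i j) z) (a b c : Fin n ⊕ Fin n) :
    dR a (fun w => riem G w b c) z =
      2 * (sesq (dMat G z (realVec a)) (realVec b) (realVec c)).re := by
  have hd : DifferentiableAt ℝ (fun w => (herm G w (realVec b) (realVec c)).re) z :=
    Complex.reCLM.differentiableAt.comp z (differentiableAt_herm hG _ _)
  simp only [dR, riem]
  rw [fderiv_const_mul hd, smul_apply, fderiv_re (differentiableAt_herm hG _ _), fderiv_herm hG]
  rfl

/-! ### The equation `dω = θ ∧ ω` at a point -/

/-- The components of `dω = ℓ ∧ ω` on arbitrary vectors, up to the factor `-2`. -/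
def LeeAt {n : ℕ} (G : MetricField n) (z : Cn n) (l : Cn n →ₗ[ℝ] ℝ) : Prop :=
  ∀ u v w, (sesq (dMat G z u) v w + sesq (dMat G z v) w u + sesq (dMat G z w) u v).im =
    l u * (sesq (G z) v w).im + l v * (sesq (G z) w u).im + l w * (sesq (G z) u v).im

/-- Both sides are real trilinear, so the frame determines them; the factor -2 in ω = -2 Im h
cancels. -/
theorem leeAt_iff {n : ℕ} {G : MetricField n} {z : Cn n}
    (hG : ∀ i j, DifferentiableAt ℝ (fun w => G w i j) z) {θ : CovectorField n}
    {l : Cn n →ₗ[ℝ] ℝ} (hl : ∀ a, θ z a = l (realVec a)) :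
    (∀ a b c, dFundForm G z a b c = wedgeFund θ G z a b c) ↔ LeeAt G z l := by
  have key : ∀ a b c, dFundForm G z a b c = wedgeFund θ G z a b c ↔
      (sesq (dMat G z (realVec a)) (realVec b) (realVec c) +
        sesq (dMat G z (realVec b)) (realVec c) (realVec a) +
        sesq (dMat G z (realVec c)) (realVec a) (realVec b)).im =
      l (realVec a) * (sesq (G z) (realVec b) (realVec c)).im +
        l (realVec b) * (sesq (G z) (realVec c) (realVec a)).im +
        l (realVec c) * (sesq (G z) (realVec a) (realVec b)).im := by
    intro a b c
    simp only [dFundForm, wedgeFund, dR_fundForm hG]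
    simp only [hl, fundForm, herm_eq_sesq, Complex.add_im]
    constructor <;> intro h <;> linarith
  constructor
  · intro h u v w
    induction u using realVec_induction with
    | h a =>
      induction v using realVec_induction with
      | h b =>
        induction w using realVec_induction with
        | h c => exact (key a b c).1 (h a b c)
        | hadd u v hu hv =>
          simp only [sesq_dMat_add, map_add, LinearMap.add_apply, Complex.add_im] at *
          linear_combination hu + hv
        | hsmul r u hu =>
          simp only [sesq_dMat_smul, sesq_real_smul_left, sesq_real_smul_right, map_smul,
            Complex.add_im, Complex.im_ofReal_mul, smul_eq_mul] at *
          linear_combination r * hu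
        | h0 => simp [sesq_dMat_zero]
      | hadd u v hu hv =>
        simp only [sesq_dMat_add, map_add, LinearMap.add_apply, Complex.add_im] at *
        linear_combination hu + hv
      | hsmul r u hu =>
        simp only [sesq_dMat_smul, sesq_real_smul_left, sesq_real_smul_right, map_smul,
            Complex.add_im, Complex.im_ofReal_mul, smul_eq_mul] at *
        linear_combination r * hu
      | h0 => simp [sesq_dMat_zero]
    | hadd u v hu hv =>
      simp only [sesq_dMat_add, map_add, LinearMap.add_apply, Complex.add_im] at *
      linear_combination hu + hv
    | hsmul r u hu =>
      simp only [sesq_dMat_smul, sesq_real_smul_left, sesq_real_smul_right, map_smul,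
            Complex.add_im, Complex.im_ofReal_mul, smul_eq_mul] at *
      linear_combination r * hu
    | h0 => simp [sesq_dMat_zero]
  · intro h a b c
    exact (key a b c).2 (h _ _ _)

/-- The `(2,1)`-part of `dω = ℓ ∧ ω`. -/
theorem LeeAt.torsion {n : ℕ} {G : MetricField n} {z : Cn n} {l : Cn n →ₗ[ℝ] ℝ}
    (h : LeeAt G z l) (hG : ∀ᶠ w in 𝓝 z, ∀ i j, conj (G w i j) = G w j i) (u v w : Cn n) :
    (sesq (dMat G z u) v w - Complex.I * sesq (dMat G z (Complex.I • u)) v w) -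
      (sesq (dMat G z v) u w - Complex.I * sesq (dMat G z (Complex.I • v)) u w) =
    (l u - Complex.I * l (Complex.I • u)) * sesq (G z) v w -
      (l v - Complex.I * l (Complex.I • v)) * sesq (G z) u w := by
  have hc : ∀ u v, conj (sesq (G z) u v) = sesq (G z) v u := sesq_conj hG.self_of_nhds
  have hd : ∀ d u v, conj (sesq (dMat G z d) u v) = sesq (dMat G z d) v u := fun d =>
    sesq_conj (dMat_conj hG d)
  -- Combining the equation on (u,v,w) with the one on (Iu,Iv,w) gives the imaginary part of the
  -- claim; (Iu,v,w) and (u,Iv,w) give its real part.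
  have h1 := h u v w
  have h2 := h (Complex.I • u) (Complex.I • v) w
  have h3 := h (Complex.I • u) v w
  have h4 := h u (Complex.I • v) w
  simp only [sesq_I_left, sesq_I_right] at h1 h2 h3 h4
  rw [← hd v u w, ← hc u w] at h1
  rw [← hd _ u w, ← hc u w] at h2 h3 h4
  simp only [Complex.add_im, Complex.mul_im, Complex.mul_re, Complex.I_re, Complex.I_im,
    Complex.conj_re, Complex.conj_im, Complex.neg_re, Complex.neg_im] at h1 h2 h3 h4
  apply Complex.ext
  · simp only [Complex.sub_re, Complex.mul_re, Complex.I_re, Complex.I_im, Complex.sub_im,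
      Complex.mul_im, Complex.ofReal_re, Complex.ofReal_im]
    linear_combination h3 + h4
  · simp only [Complex.sub_re, Complex.mul_re, Complex.I_re, Complex.I_im, Complex.sub_im,
      Complex.mul_im, Complex.ofReal_re, Complex.ofReal_im]
    linear_combination h1 - h2

/-! ### The dual vector of a covector and parallel 1-forms -/

theorem riem_mulVec {n : ℕ} (G : MetricField n) (z : Cn n) (x : Fin n ⊕ Fin n → ℝ)
    (a : Fin n ⊕ Fin n) :
    (riem G z).mulVec x a = 2 * (sesq (G z) (realVec a) (∑ b, x b • realVec b)).re := by
  simp only [Matrix.mulVec, dotProduct, riem, map_sum, sesq_real_smul_right, Complex.re_sum,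
    Complex.re_ofReal_mul, Finset.mul_sum, herm_eq_sesq]
  exact Finset.sum_congr rfl fun b _ => by ring

theorem riem_vecMul {n : ℕ} (G : MetricField n) (z : Cn n) (x : Fin n ⊕ Fin n → ℝ)
    (a : Fin n ⊕ Fin n) :
    (riem G z).vecMul x a = 2 * (sesq (G z) (∑ b, x b • realVec b) (realVec a)).re := by
  simp only [Matrix.vecMul, dotProduct, riem, map_sum, herm_eq_sesq, LinearMap.sum_apply, sesq_real_smul_left, Complex.re_sum, Complex.re_ofReal_mul,
    Finset.mul_sum]
  exact Finset.sum_congr rfl fun b _ => by ring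

/-- A kernel vector X satisfies Re h(u,X) = 0 for all u, in particular for u = X, so positivity
forces X = 0. -/
theorem isUnit_riem {n : ℕ} {G : MetricField n} {z : Cn n}
    (hpos : ∀ u, u ≠ 0 → 0 < (sesq (G z) u u).re) : IsUnit (riem G z) := by
  rw [← Matrix.mulVec_injective_iff_isUnit]
  refine (injective_iff_map_eq_zero (riem G z).mulVecLin).2 fun x hx => ?_
  set X : Cn n := ∑ b, x b • realVec b with hX
  have h1 : ∀ u : Cn n, (sesq (G z) u X).re = 0 := by
    intro u
    induction u using realVec_induction with
    | h a =>
      have := congrFun hx a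
      rw [Matrix.mulVecLin_apply, riem_mulVec, ← hX] at this
      simpa using this
    | hadd u v hu hv => simp [hu, hv]
    | hsmul r u hu => simp [hu]
    | h0 => simp
  have h2 : X = 0 := by
    by_contra h
    exact (hpos X h).ne' (h1 X)
  rw [← realCoord_sum x, ← hX, h2]
  ext a
  rcases a with i | i <;> simp [realCoord]

theorem exists_dual {n : ℕ} {G : MetricField n} {z : Cn n}
    (hpos : ∀ u, u ≠ 0 → 0 < (sesq (G z) u u).re) (l : Cn n →ₗ[ℝ] ℝ) :
    ∃ X : Cn n, ∀ d, 2 * (sesq (G z) X d).re = l d := by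
  obtain ⟨R, hR⟩ := (isUnit_riem hpos).exists_left_inv
  refine ⟨∑ a, (R.vecMul fun a => l (realVec a)) a • realVec a, fun d => ?_⟩
  induction d using realVec_induction with
  | h a => rw [← riem_vecMul, Matrix.vecMul_vecMul, hR, Matrix.vecMul_one]
  | hadd u v hu hv => rw [map_add, map_add, Complex.add_re, mul_add, hu, hv]
  | hsmul r u hu =>
    rw [sesq_real_smul_right, Complex.re_ofReal_mul, map_smul, smul_eq_mul, ← hu]; ring
  | h0 => simp

/-- Since ℓ is X with its index lowered, contracting Γ_{ab}^c with ℓ_c cancels the inverse metric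
and leaves the Christoffel symbol of the first kind, evaluated on X. -/
theorem sum_christoffel_mul {n : ℕ} {G : MetricField n} {z : Cn n}
    (hG : ∀ i j, DifferentiableAt ℝ (fun w => G w i j) z)
    (hpos : ∀ u, u ≠ 0 → 0 < (sesq (G z) u u).re) {l : Cn n →ₗ[ℝ] ℝ} {X : Cn n}
    (hX : ∀ d, 2 * (sesq (G z) X d).re = l d) (a b : Fin n ⊕ Fin n) :
    ∑ c, christoffel G z a b c * l (realVec c) =
      (sesq (dMat G z (realVec a)) (realVec b) X + sesq (dMat G z (realVec b)) (realVec a) X -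
        sesq (dMat G z X) (realVec a) (realVec b)).re := by
  have hl : (fun c => l (realVec c)) = (riem G z).vecMul (realCoord X) := by
    ext c
    rw [riem_vecMul, sum_realCoord_smul, hX]
  -- The first-kind symbol is real linear in its last slot, which allows passing from frame vectors
  -- to X.
  have hK : ∀ d, (sesq (dMat G z (realVec a)) (realVec b) d +
      sesq (dMat G z (realVec b)) (realVec a) d - sesq (dMat G z d) (realVec a) (realVec b)).re =
      ∑ e, realCoord d e * (sesq (dMat G z (realVec a)) (realVec b) (realVec e) +
      sesq (dMat G z (realVec b)) (realVec a) (realVec e) -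
        sesq (dMat G z (realVec e)) (realVec a) (realVec b)).re := by
    intro d
    let Φ : Cn n →ₗ[ℝ] ℝ :=
      { toFun := fun d => (sesq (dMat G z (realVec a)) (realVec b) d +
          sesq (dMat G z (realVec b)) (realVec a) d -
            sesq (dMat G z d) (realVec a) (realVec b)).re
        map_add' := fun x y => by
          simp only [sesq_dMat_add, map_add, Complex.sub_re, Complex.add_re]; ring
        map_smul' := fun r x => by
          simp only [sesq_dMat_smul, sesq_real_smul_right, Complex.sub_re, Complex.add_re,
            Complex.re_ofReal_mul, RingHom.id_apply, smul_eq_mul]; ring }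
    change Φ d = ∑ e, realCoord d e * Φ (realVec e)
    conv_lhs => rw [← sum_realCoord_smul d, map_sum]
    simp only [map_smul, smul_eq_mul]
  have hdet := (Matrix.isUnit_iff_isUnit_det _).1 (isUnit_riem hpos)
  set K : Fin n ⊕ Fin n → ℝ := fun e => (sesq (dMat G z (realVec a)) (realVec b) (realVec e) +
      sesq (dMat G z (realVec b)) (realVec a) (realVec e) -
        sesq (dMat G z (realVec e)) (realVec a) (realVec b)).re with hKdef
  have hc : ∀ c, christoffel G z a b c = ((riem G z)⁻¹).mulVec K c := by
    intro c
    simp only [christoffel, dR_riem hG, Matrix.mulVec, dotProduct, Finset.mul_sum, hKdef,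
      Complex.sub_re, Complex.add_re]
    exact Finset.sum_congr rfl fun b _ => by ring
  calc _ = (fun c => l (realVec c)) ⬝ᵥ ((riem G z)⁻¹).mulVec K := by
        simp only [dotProduct, hc, mul_comm]
    _ = realCoord X ⬝ᵥ K := by
        rw [hl, Matrix.dotProduct_mulVec, Matrix.vecMul_vecMul, Matrix.mul_nonsing_inv _ hdet,
          Matrix.vecMul_one]
    _ = _ := (hK X).symm

/-- The equation `∇dF = 0` at a point, on arbitrary vectors; `X` is the vector dual to `-dF`. -/
def ParallelAt {n : ℕ} (G : MetricField n) (F : Cn n → ℝ) (z X : Cn n) : Prop :=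
  ∀ u v, fderiv ℝ (fderiv ℝ F) z u v =
    -(sesq (dMat G z u) v X + sesq (dMat G z v) u X - sesq (dMat G z X) u v).re

/-- For θ = -dF the derivative ∂_aθ_b is minus the Hessian of F, and the connection term is the
first-kind symbol on X. The relation θ = -dF is needed near z because θ gets differentiated. -/
theorem parallelAt_iff {n : ℕ} {G : MetricField n} {z : Cn n}
    (hG : ∀ i j, DifferentiableAt ℝ (fun w => G w i j) z)
    (hpos : ∀ u, u ≠ 0 → 0 < (sesq (G z) u u).re) {F : Cn n → ℝ}
    (hF : DifferentiableAt ℝ (fderiv ℝ F) z) {θ : CovectorField n}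
    (hθ : ∀ᶠ w in 𝓝 z, ∀ a, θ w a = -fderiv ℝ F w (realVec a)) {X : Cn n}
    (hX : ∀ d, 2 * (sesq (G z) X d).re = -fderiv ℝ F z d) :
    (∀ a b, nablaCovector G θ z a b = 0) ↔ ParallelAt G F z X := by
  have key : ∀ a b, nablaCovector G θ z a b = 0 ↔
      fderiv ℝ (fderiv ℝ F) z (realVec a) (realVec b) =
        -(sesq (dMat G z (realVec a)) (realVec b) X + sesq (dMat G z (realVec b)) (realVec a) X -
          sesq (dMat G z X) (realVec a) (realVec b)).re := by
    intro a b
    have h1 : dR a (fun w => θ w b) z = -fderiv ℝ (fderiv ℝ F) z (realVec a) (realVec b) := by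
      have h : HasFDerivAt (fun w => -fderiv ℝ F w (realVec b))
          (-(ContinuousLinearMap.apply ℝ ℝ (realVec b)).comp (fderiv ℝ (fderiv ℝ F) z)) z :=
        ((ContinuousLinearMap.apply ℝ ℝ (realVec b)).hasFDerivAt.comp z hF.hasFDerivAt).neg
      rw [dR, Filter.EventuallyEq.fderiv_eq (hθ.mono fun w hw => hw b), h.fderiv]
      rfl
    have h2 := sum_christoffel_mul hG hpos (l := -(fderiv ℝ F z : Cn n →ₗ[ℝ] ℝ)) hX a b
    have h3 : ∑ c, christoffel G z a b c * θ z c =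
        ∑ c, christoffel G z a b c * (-(fderiv ℝ F z : Cn n →ₗ[ℝ] ℝ)) (realVec c) :=
      Finset.sum_congr rfl fun c _ => by rw [hθ.self_of_nhds c]; rfl
    rw [nablaCovector, h1, h3, h2]
    constructor <;> intro h <;> linarith
  constructor
  · intro h u v
    induction u using realVec_induction with
    | h a =>
      induction v using realVec_induction with
      | h b => exact (key a b).1 (h a b)
      | hadd u v hu hv =>
        simp only [sesq_dMat_add, map_add, LinearMap.add_apply, Complex.sub_re,
          Complex.add_re] at *
        linear_combination hu + hv
      | hsmul r u hu =>
        simp only [sesq_dMat_smul, sesq_real_smul_left, sesq_real_smul_right, map_smul,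
          Complex.add_re, Complex.sub_re, Complex.re_ofReal_mul, smul_eq_mul] at *
        linear_combination r * hu
      | h0 => simp [sesq_dMat_zero]
    | hadd u v hu hv =>
      simp only [sesq_dMat_add, map_add, LinearMap.add_apply, add_apply, Complex.sub_re,
        Complex.add_re] at *
      linear_combination hu + hv
    | hsmul r u hu =>
      simp only [sesq_dMat_smul, sesq_real_smul_left, map_smul, smul_apply,
        Complex.add_re, Complex.sub_re, Complex.re_ofReal_mul, smul_eq_mul] at *
      linear_combination r * hu
    | h0 => simp [sesq_dMat_zero]
  · intro h a b
    exact (key a b).2 (h _ _)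

/-- The complex Hessian of `F` when `-dF` is the parallel Lee form. -/
theorem complexHessian_of_parallel {n : ℕ} {G : MetricField n} {z : Cn n}
    (hG : ∀ᶠ w in 𝓝 z, ∀ i j, conj (G w i j) = G w j i) {F : Cn n → ℝ}
    {l : Cn n →ₗ[ℝ] ℝ} {X : Cn n}
    (hX : ∀ d, 2 * (sesq (G z) X d).re = l d) (hL : LeeAt G z l) (hP : ParallelAt G F z X)
    (u : Cn n) :
    fderiv ℝ (fderiv ℝ F) z u u + fderiv ℝ (fderiv ℝ F) z (Complex.I • u) (Complex.I • u) =
      4 * ((sesq (G z) X X).re * (sesq (G z) u u).re - Complex.normSq (sesq (G z) u X)) := by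
  have hc := hG.self_of_nhds
  have hd : ∀ d u v, conj (sesq (dMat G z d) u v) = sesq (dMat G z d) v u := fun d =>
    sesq_conj (dMat_conj hG d)
  -- The triple (u, Iu, X) is chosen because the derivatives of h in dω(u, Iu, X) are, up to the
  -- factor -2, those remaining in Hess F(u,u) + Hess F(Iu,Iu).
  have h1 := hL u (Complex.I • u) X
  rw [← hX, ← hX, ← hX, sesq_re_comm hc X u, sesq_re_comm hc X (Complex.I • u)] at h1
  rw [hP, hP]
  simp only [sesq_I_left, sesq_I_right] at h1 ⊢
  rw [← hd _ u X, sesq_im_comm hc X u] at h1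
  have h0 := sesq_self_im hc u
  simp only [Complex.add_im, Complex.sub_re, Complex.add_re, Complex.mul_im, Complex.mul_re,
    Complex.I_re, Complex.I_im, Complex.conj_re, Complex.conj_im, Complex.neg_re,
    Complex.neg_im, Complex.normSq_apply] at h1 ⊢
  linear_combination -2 * h1

/-! ### Wirtinger derivatives -/

theorem dZbar_conj {n : ℕ} (i : Fin n) (f : Cn n → ℂ) (z : Cn n) :
    dZbar i (fun w => conj (f w)) z = conj (dZ i f z) := by
  simp only [dZ, dZbar, fderiv_conj, map_mul, map_sub, Complex.conj_I, map_div₀, map_one,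
    Complex.conj_ofNat]
  ring

theorem dZ_congr {n : ℕ} (i : Fin n) {f g : Cn n → ℂ} {z : Cn n} (h : f =ᶠ[𝓝 z] g) :
    dZ i f z = dZ i g z := by
  simp only [dZ, h.fderiv_eq]

theorem dZbar_congr {n : ℕ} (i : Fin n) {f g : Cn n → ℂ} {z : Cn n} (h : f =ᶠ[𝓝 z] g) :
    dZbar i f z = dZbar i g z := by
  simp only [dZbar, h.fderiv_eq]

theorem dZ_mul {n : ℕ} (i : Fin n) {f g : Cn n → ℂ} {z : Cn n} (hf : DifferentiableAt ℝ f z)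
    (hg : DifferentiableAt ℝ g z) :
    dZ i (fun w => f w * g w) z = dZ i f z * g z + f z * dZ i g z := by
  simp only [dZ, fderiv_fun_mul hf hg, add_apply, smul_apply, smul_eq_mul]
  ring

theorem dZbar_mul {n : ℕ} (i : Fin n) {f g : Cn n → ℂ} {z : Cn n} (hf : DifferentiableAt ℝ f z)
    (hg : DifferentiableAt ℝ g z) :
    dZbar i (fun w => f w * g w) z = dZbar i f z * g z + f z * dZbar i g z := by
  simp only [dZbar, fderiv_fun_mul hf hg, add_apply, smul_apply, smul_eq_mul]
  ring

theorem dZbar_add {n : ℕ} (i : Fin n) {f g : Cn n → ℂ} {z : Cn n} (hf : DifferentiableAt ℝ f z)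
    (hg : DifferentiableAt ℝ g z) :
    dZbar i (fun w => f w + g w) z = dZbar i f z + dZbar i g z := by
  simp only [dZbar, fderiv_fun_add hf hg, add_apply]
  ring

theorem dZbar_sum {n : ℕ} {ι : Type*} (s : Finset ι) (i : Fin n) {f : ι → Cn n → ℂ} {z : Cn n}
    (hf : ∀ a ∈ s, DifferentiableAt ℝ (f a) z) :
    dZbar i (fun w => ∑ a ∈ s, f a w) z = ∑ a ∈ s, dZbar i (f a) z := by
  simp only [dZbar, fderiv_fun_sum hf, sum_apply, Finset.mul_sum, ← Finset.sum_add_distrib]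

theorem dZ_eq_dMat {n : ℕ} (G : MetricField n) (z : Cn n) (k i j : Fin n) :
    dZ k (fun w => G w i j) z = (1 / 2) * (sesq (dMat G z (unitVec k)) (unitVec i) (unitVec j) -
      Complex.I * sesq (dMat G z (Complex.I • unitVec k)) (unitVec i) (unitVec j)) := by
  simp only [sesq_unitVec]
  rfl

/-- The `(1,1)`-part of a real bilinear map, as a sesquilinear form. -/
noncomputable def levi {n : ℕ} (B : Cn n →L[ℝ] Cn n →L[ℝ] ℂ) : Cn n →ₗ[ℂ] Cn n →ₗ⋆[ℂ] ℂ :=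
  LinearMap.mk₂'ₛₗ (RingHom.id ℂ) (starRingEnd ℂ)
    (fun u v => (1 / 4) * (B v u - Complex.I * B v (Complex.I • u) +
      Complex.I * B (Complex.I • v) u + B (Complex.I • v) (Complex.I • u)))
    (fun u u' v => by simp only [smul_add, map_add]; ring)
    (fun c u v => by
      have h : c • u = c.re • u + c.im • (Complex.I • u) := by
        rw [← Complex.coe_smul, ← Complex.coe_smul, smul_smul, ← add_smul, Complex.re_add_im]
      have h' : Complex.I • c • u = c.re • (Complex.I • u) - c.im • u := by
        rw [h, smul_add, smul_comm _ c.re, smul_comm _ c.im, smul_smul _ _ u, Complex.I_mul_I,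
          neg_one_smul, smul_neg, sub_eq_add_neg]
      rw [h', h]
      simp only [map_add, map_sub, map_smul, Complex.real_smul, RingHom.id_apply, smul_eq_mul]
      conv_rhs => rw [← Complex.re_add_im c]
      linear_combination ((c.im : ℂ) / 4 * (B v (Complex.I • u) - B (Complex.I • v) u)) *
        Complex.I_sq)
    (fun u v v' => by simp only [smul_add, map_add, add_apply]; ring)
    (fun c v u => by
      have h : c • u = c.re • u + c.im • (Complex.I • u) := by
        rw [← Complex.coe_smul, ← Complex.coe_smul, smul_smul, ← add_smul, Complex.re_add_im]
      have h' : Complex.I • c • u = c.re • (Complex.I • u) - c.im • u := by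
        rw [h, smul_add, smul_comm _ c.re, smul_comm _ c.im, smul_smul _ _ u, Complex.I_mul_I,
          neg_one_smul, smul_neg, sub_eq_add_neg]
      have hc : conj c = c.re - c.im * Complex.I := by
        apply Complex.ext <;> simp
      rw [h', h, hc]
      simp only [map_add, map_sub, map_smul, Complex.real_smul, smul_eq_mul, add_apply,
        sub_apply, smul_apply]
      linear_combination ((c.im : ℂ) / 4 * (B (Complex.I • u) v - B u (Complex.I • v))) *
        Complex.I_sq)

theorem levi_apply {n : ℕ} (B : Cn n →L[ℝ] Cn n →L[ℝ] ℂ) (u v : Cn n) :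
    levi B u v = (1 / 4) * (B v u - Complex.I * B v (Complex.I • u) +
      Complex.I * B (Complex.I • v) u + B (Complex.I • v) (Complex.I • u)) := rfl

theorem fderiv_dZ {n : ℕ} (i : Fin n) {f : Cn n → ℂ} {z : Cn n} (hf : ContDiffAt ℝ 2 f z) :
    DifferentiableAt ℝ (dZ i f) z ∧ ∀ d, fderiv ℝ (dZ i f) z d =
      (1 / 2) * (fderiv ℝ (fderiv ℝ f) z d (unitVec i) -
        Complex.I * fderiv ℝ (fderiv ℝ f) z d (Complex.I • unitVec i)) := by
  have h1 : DifferentiableAt ℝ (fderiv ℝ f) z :=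
    (hf.fderiv_right (m := 1) (by norm_num)).differentiableAt (by norm_num)
  have h2 : ∀ v, HasFDerivAt (fun w => fderiv ℝ f w v)
      ((ContinuousLinearMap.apply ℝ ℂ v).comp (fderiv ℝ (fderiv ℝ f) z)) z := fun v =>
    (ContinuousLinearMap.apply ℝ ℂ v).hasFDerivAt.comp z h1.hasFDerivAt
  have h3 := ((h2 (unitVec i)).sub ((h2 (Complex.I • unitVec i)).const_mul Complex.I)).const_mul
    (1 / 2 : ℂ)
  refine ⟨h3.differentiableAt, fun d => ?_⟩
  have h4 : fderiv ℝ (dZ i f) z = _ := h3.fderiv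
  rw [h4]
  simp

theorem dZbar_dZ {n : ℕ} (i j : Fin n) {f : Cn n → ℂ} {z : Cn n} (hf : ContDiffAt ℝ 2 f z) :
    dZbar j (dZ i f) z = levi (fderiv ℝ (fderiv ℝ f) z) (unitVec i) (unitVec j) := by
  rw [dZbar, (fderiv_dZ i hf).2, (fderiv_dZ i hf).2, levi_apply]
  linear_combination (-1 / 4 * fderiv ℝ (fderiv ℝ f) z (Complex.I • unitVec j)
    (Complex.I • unitVec i)) * Complex.I_sq

/-- Conjugation exchanges ∂ and ∂̄; symmetry of the second derivative restores their order. -/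
theorem levi_conj {n : ℕ} {f g : Cn n → ℂ} {z : Cn n} (hf : ContDiffAt ℝ 2 f z)
    (h : (fun w => conj (f w)) =ᶠ[𝓝 z] g) (u v : Cn n) :
    conj (levi (fderiv ℝ (fderiv ℝ f) z) u v) = levi (fderiv ℝ (fderiv ℝ g) z) v u := by
  have hs : ∀ u v, fderiv ℝ (fderiv ℝ f) z u v = fderiv ℝ (fderiv ℝ f) z v u :=
    hf.isSymmSndFDerivAt (by simp)
  have h1 : fderiv ℝ g =ᶠ[𝓝 z]
      fun w => (Complex.conjCLE : ℂ →L[ℝ] ℂ).comp (fderiv ℝ f w) := by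
    refine h.symm.fderiv.trans (Filter.Eventually.of_forall fun w => ?_)
    exact Complex.conjCLE.comp_fderiv (f := f) (x := w)
  have h2 : ∀ u v, fderiv ℝ (fderiv ℝ g) z u v = conj (fderiv ℝ (fderiv ℝ f) z u v) := by
    intro u v
    have h3 : DifferentiableAt ℝ (fderiv ℝ f) z :=
      (hf.fderiv_right (m := 1) (by norm_num)).differentiableAt (by norm_num)
    have h4 := ((ContinuousLinearMap.compL ℝ (Cn n) ℂ ℂ
      (Complex.conjCLE : ℂ →L[ℝ] ℂ)).hasFDerivAt.comp z h3.hasFDerivAt).fderiv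
    rw [h1.fderiv_eq]
    exact congrArg (fun L : Cn n →L[ℝ] Cn n →L[ℝ] ℂ => L u v) h4
  simp only [levi_apply, h2]
  rw [hs v u, hs v (Complex.I • u), hs (Complex.I • v) u, hs (Complex.I • v) (Complex.I • u)]
  simp only [map_mul, map_add, map_sub, Complex.conj_I, map_div₀, map_one, Complex.conj_ofNat]
  ring

/-- On the diagonal the two mixed terms cancel by symmetry, leaving a quarter of the Laplacian along
the complex line of u. -/
theorem levi_ofReal_self {n : ℕ} {F : Cn n → ℝ} {z : Cn n} (hF : ContDiffAt ℝ 2 F z) (u : Cn n) :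
    levi (fderiv ℝ (fderiv ℝ fun w => (F w : ℂ)) z) u u =
      ((1 / 4 * (fderiv ℝ (fderiv ℝ F) z u u +
        fderiv ℝ (fderiv ℝ F) z (Complex.I • u) (Complex.I • u)) : ℝ) : ℂ) := by
  have hs : ∀ u v, fderiv ℝ (fderiv ℝ F) z u v = fderiv ℝ (fderiv ℝ F) z v u :=
    hF.isSymmSndFDerivAt (by simp)
  have h1 : fderiv ℝ (fun w => (F w : ℂ)) =ᶠ[𝓝 z]
      fun w => Complex.ofRealCLM.comp (fderiv ℝ F w) := by
    filter_upwards [hF.eventually (by simp)] with w hw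
    exact (Complex.ofRealCLM.hasFDerivAt.comp w
      (hw.differentiableAt (by norm_num)).hasFDerivAt).fderiv
  have h2 : ∀ u v, fderiv ℝ (fderiv ℝ fun w => (F w : ℂ)) z u v =
      (fderiv ℝ (fderiv ℝ F) z u v : ℂ) := by
    intro u v
    have h3 : DifferentiableAt ℝ (fderiv ℝ F) z :=
      (hF.fderiv_right (m := 1) (by norm_num)).differentiableAt (by norm_num)
    have h4 := ((ContinuousLinearMap.compL ℝ (Cn n) ℝ ℂ
      Complex.ofRealCLM).hasFDerivAt.comp z h3.hasFDerivAt).fderiv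
    rw [h1.fderiv_eq]
    exact congrArg (fun L : Cn n →L[ℝ] Cn n →L[ℝ] ℂ => L u v) h4
  simp only [levi_apply, h2]
  rw [hs (Complex.I • u) u]
  push_cast
  ring

/-! ### The Chern connection and its curvature in coordinates -/

/-- `G` is a `C²` Hermitian metric near `z`. -/
structure HermitianAt {n : ℕ} (G : MetricField n) (z : Cn n) : Prop where
  contDiff : ∀ i j, ContDiffAt ℝ 2 (fun w => G w i j) z
  herm : ∀ᶠ w in 𝓝 z, ∀ i j, conj (G w i j) = G w j i
  pos : ∀ᶠ w in 𝓝 z, ∀ u, u ≠ 0 → 0 < (sesq (G w) u u).re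

theorem HermitianAt.eventually {n : ℕ} {G : MetricField n} {z : Cn n} (h : HermitianAt G z) :
    ∀ᶠ w in 𝓝 z, HermitianAt G w := by
  have h1 : ∀ᶠ w in 𝓝 z, ∀ i j, ContDiffAt ℝ 2 (fun w => G w i j) w := by
    rw [Filter.eventually_all]; intro i
    rw [Filter.eventually_all]; intro j
    exact (h.contDiff i j).eventually (by simp)
  filter_upwards [h1, h.herm.eventually_nhds, h.pos.eventually_nhds] with w h1 h2 h3
  exact ⟨h1, h2, h3⟩

theorem HermitianAt.differentiableAt {n : ℕ} {G : MetricField n} {z : Cn n}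
    (h : HermitianAt G z) (i j : Fin n) : DifferentiableAt ℝ (fun w => G w i j) z :=
  (h.contDiff i j).differentiableAt (by norm_num)

theorem isUnit_of_pos {n : ℕ} {A : Matrix (Fin n) (Fin n) ℂ}
    (hpos : ∀ u : Cn n, u ≠ 0 → 0 < (sesq A u u).re) : IsUnit A := by
  rw [← Matrix.vecMul_injective_iff_isUnit]
  refine (injective_iff_map_eq_zero A.vecMulLinear).2 fun x hx => ?_
  have h1 : sesq A (WithLp.toLp 2 x) (WithLp.toLp 2 x) = 0 := by
    rw [sesq_apply, Finset.sum_comm]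
    refine Finset.sum_eq_zero fun j _ => ?_
    have := congrFun hx j
    simp only [Matrix.vecMulLinear_apply, Matrix.vecMul, dotProduct, Pi.zero_apply] at this
    rw [← Finset.sum_mul]
    simp only [mul_comm (A _ _), this, zero_mul]
  by_contra h
  have h2 := hpos (WithLp.toLp 2 x) (by simpa using h)
  simp [h1] at h2

theorem HermitianAt.isUnit {n : ℕ} {G : MetricField n} {z : Cn n} (h : HermitianAt G z) :
    IsUnit (G z) := isUnit_of_pos h.pos.self_of_nhds

theorem sum_chernGamma_mul {n : ℕ} {G : MetricField n} {z : Cn n} (h : IsUnit (G z))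
    (k i l : Fin n) : ∑ m, chernGamma G z k i m * G z m l = dZ k (fun w => G w i l) z := by
  have hdet := (Matrix.isUnit_iff_isUnit_det _).1 h
  have h2 : (Matrix.vecMul (Matrix.vecMul (fun p => dZ k (fun w => G w i p) z) (G z)⁻¹) (G z)) l =
      dZ k (fun w => G w i l) z := by
    rw [Matrix.vecMul_vecMul, Matrix.nonsing_inv_mul _ hdet, Matrix.vecMul_one]
  rw [← h2]
  simp only [Matrix.vecMul, dotProduct, chernGamma, invMetric, mul_comm]

/-- Used to compare connection coefficients after lowering an index, where they become plain
derivatives of the metric. -/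
theorem vecMul_cancel {n : ℕ} {A : Matrix (Fin n) (Fin n) ℂ} (h : IsUnit A) {x y : Fin n → ℂ}
    (hxy : ∀ l, ∑ m, x m * A m l = ∑ m, y m * A m l) : x = y :=
  Matrix.vecMul_injective_iff_isUnit.2 h (funext hxy)

theorem HermitianAt.differentiableAt_inv {n : ℕ} {G : MetricField n} {z : Cn n}
    (h : HermitianAt G z) (i j : Fin n) : DifferentiableAt ℝ (fun w => invMetric G w i j) z := by
  have hdet := ((Matrix.isUnit_iff_isUnit_det _).1 h.isUnit).ne_zero
  have key : ∀ H : MetricField n, (∀ i j, DifferentiableAt ℝ (fun w => H w i j) z) →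
      DifferentiableAt ℝ (fun w => (H w).det) z := by
    intro H hH
    simp only [Matrix.det_apply']
    fun_prop
  simp only [invMetric, Matrix.inv_def, Matrix.smul_apply, Ring.inverse_eq_inv', smul_eq_mul,
    Matrix.adjugate_apply]
  refine ((key G h.differentiableAt).inv hdet).mul (key _ fun a b => ?_)
  -- By Cramer's rule each entry of the adjugate is a determinant of the metric with one row
  -- replaced by a constant vector; every other row stays differentiable.
  by_cases ha : a = i
  · subst ha
    simp
  · simpa [Matrix.updateRow_ne ha] using h.differentiableAt a b

theorem HermitianAt.differentiableAt_chernGamma {n : ℕ} {G : MetricField n} {z : Cn n}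
    (h : HermitianAt G z) (k i j : Fin n) :
    DifferentiableAt ℝ (fun w => chernGamma G w k i j) z :=
  DifferentiableAt.fun_sum fun m _ =>
    (h.differentiableAt_inv j m).mul (fderiv_dZ k (h.contDiff i m)).1

theorem HermitianAt.dZbar_eq {n : ℕ} {G : MetricField n} {z : Cn n}
    (h : HermitianAt G z) (j m l : Fin n) :
    dZbar j (fun w => G w m l) z = ∑ p, conj (chernGamma G z j l p) * G z m p := by
  rw [dZbar_congr j (h.herm.mono fun w hw => (hw l m).symm), dZbar_conj,
    ← sum_chernGamma_mul h.isUnit, map_sum]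
  simp only [map_mul, h.herm.self_of_nhds _ _]

/-- Apply ∂_{\bar j} to Γ_{ik}^m g_{m\bar l} = ∂_i g_{k\bar l}. This form avoids derivatives of the
inverse metric and makes the conjugation symmetry visible. -/
theorem HermitianAt.chernCurv_eq {n : ℕ} {G : MetricField n} {z : Cn n}
    (h : HermitianAt G z) (i j k l : Fin n) :
    chernCurv G z i j k l =
      -levi (fderiv ℝ (fderiv ℝ fun w => G w k l) z) (unitVec i) (unitVec j) +
        ∑ m, ∑ p, chernGamma G z i k m * conj (chernGamma G z j l p) * G z m p := by
  have hE : (fun w => ∑ m, chernGamma G w i k m * G w m l) =ᶠ[𝓝 z] dZ i fun w => G w k l :=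
    h.eventually.mono fun w hw => sum_chernGamma_mul hw.isUnit i k l
  have h1 := dZbar_congr j hE
  rw [dZbar_sum _ _ fun m _ => (h.differentiableAt_chernGamma i k m).fun_mul (h.differentiableAt m l),
    dZbar_dZ i j (h.contDiff k l)] at h1
  simp only [dZbar_mul j (h.differentiableAt_chernGamma i k _) (h.differentiableAt _ l),
    Finset.sum_add_distrib, h.dZbar_eq, Finset.mul_sum] at h1
  rw [← h1, chernCurv]
  simp only [neg_mul, Finset.sum_neg_distrib, mul_assoc]
  ring

theorem HermitianAt.conj_chernCurv {n : ℕ} {G : MetricField n} {z : Cn n}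
    (h : HermitianAt G z) (i j k l : Fin n) :
    conj (chernCurv G z i j k l) = chernCurv G z j i l k := by
  rw [h.chernCurv_eq, h.chernCurv_eq, map_add, map_neg,
    levi_conj (h.contDiff k l) (h.herm.mono fun w hw => hw k l)]
  congr 1
  simp only [map_sum, map_mul, Complex.conj_conj, h.herm.self_of_nhds _ _]
  rw [Finset.sum_comm]
  exact Finset.sum_congr rfl fun _ _ => Finset.sum_congr rfl fun _ _ => by ring

/-- Symmetry of the curvature of a Kähler metric. -/
theorem HermitianAt.chernCurv_symm {n : ℕ} {G : MetricField n} {z : Cn n}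
    (h : HermitianAt G z) (hK : ∀ᶠ w in 𝓝 z, LeeAt G w 0) (i j k l : Fin n) :
    chernCurv G z i j k l = chernCurv G z k l i j := by
  -- The Kähler condition makes Γ symmetric in its lower indices on a neighbourhood. This swaps the
  -- two unbarred indices; conjugation then gives the swap of the barred ones.
  have h1 : ∀ i j k l, chernCurv G z i j k l = chernCurv G z k j i l := by
    intro i j k l
    simp only [chernCurv]
    refine Finset.sum_congr rfl fun m _ => ?_
    rw [dZbar_congr j]
    filter_upwards [h.eventually, hK] with w hw hwK
    refine congrFun (vecMul_cancel hw.isUnit fun l => ?_) m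
    rw [sum_chernGamma_mul hw.isUnit, sum_chernGamma_mul hw.isUnit, dZ_eq_dMat, dZ_eq_dMat]
    have := hwK.torsion hw.herm (unitVec i) (unitVec k) (unitVec l)
    simp only [LinearMap.zero_apply, Complex.ofReal_zero, mul_zero, sub_zero, zero_mul] at this
    rw [sub_eq_zero.1 this]
  rw [h1, ← h.conj_chernCurv, h1, h.conj_chernCurv]

theorem evalDiag_comm {n : ℕ} {A : Fin n → Fin n → Fin n → Fin n → ℂ}
    (hA : ∀ i j k l, A i j k l = A k l i j) (u v : Cn n) : evalDiag A u v = evalDiag A v u := by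
  calc evalDiag A u v = ∑ i, ∑ k, ∑ l, ∑ j, A i j k l * u i * conj (u j) * v k * conj (v l) := by
        refine Finset.sum_congr rfl fun i _ => ?_
        rw [Finset.sum_comm]
        exact Finset.sum_congr rfl fun k _ => Finset.sum_comm
    _ = ∑ k, ∑ l, ∑ i, ∑ j, A i j k l * u i * conj (u j) * v k * conj (v l) := by
        rw [Finset.sum_comm]
        exact Finset.sum_congr rfl fun k _ => Finset.sum_comm
    _ = _ := by
        refine Finset.sum_congr rfl fun k _ => Finset.sum_congr rfl fun l _ =>
          Finset.sum_congr rfl fun i _ => Finset.sum_congr rfl fun j _ => ?_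
        rw [hA]
        ring

/-- The Chern curvature of a conformally changed metric. -/
theorem chernCurv_conformal {n : ℕ} {G G' : MetricField n} {F : Cn n → ℝ} {z : Cn n}
    (h : HermitianAt G z) (h' : HermitianAt G' z) (hF : ContDiffAt ℝ 2 F z)
    (hGG : ∀ᶠ w in 𝓝 z, ∀ i j, G' w i j = Real.exp (F w) * G w i j) (i j k l : Fin n) :
    chernCurv G' z i j k l = Real.exp (F z) * (chernCurv G z i j k l -
      levi (fderiv ℝ (fderiv ℝ fun w => (F w : ℂ)) z) (unitVec i) (unitVec j) * G z k l) := by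
  have hFC : ContDiffAt ℝ 2 (fun w => (F w : ℂ)) z :=
    Complex.ofRealCLM.contDiff.contDiffAt.comp z hF
  -- The connection changes by ∂_iF times the identity; applying ∂_{\bar j} to this correction
  -- produces the Levi form of F.
  have h1 : ∀ m, (fun w => chernGamma G' w i k m) =ᶠ[𝓝 z]
      fun w => chernGamma G w i k m + dZ i (fun w => (F w : ℂ)) w * (if m = k then 1 else 0) := by
    intro m
    filter_upwards [h.eventually, h'.eventually, hFC.eventually (by simp),
      hGG.eventually_nhds] with w hw hw' hFw hGw
    refine congrFun (vecMul_cancel (y := fun m => chernGamma G w i k m +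
      dZ i (fun w => (F w : ℂ)) w * (if m = k then 1 else 0)) hw'.isUnit fun l => ?_) m
    rw [sum_chernGamma_mul hw'.isUnit]
    have hFd := hFw.differentiableAt (by norm_num)
    have hexp : HasFDerivAt (fun w => Complex.exp (F w))
        (Complex.exp (F w) • fderiv ℝ (fun w => (F w : ℂ)) w) w := hFd.hasFDerivAt.cexp
    have hexp' : dZ i (fun w => Complex.exp (F w)) w =
        Complex.exp (F w) * dZ i (fun w => (F w : ℂ)) w := by
      simp only [dZ, hexp.fderiv, smul_apply, smul_eq_mul]
      ring
    rw [dZ_congr i (g := fun w => Complex.exp (F w) * G w k l)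
      (hGw.mono fun w hw => by simpa using hw k l),
      dZ_mul i hexp.differentiableAt (hw.differentiableAt k l), hexp',
      ← sum_chernGamma_mul hw.isUnit]
    simp only [hGw.self_of_nhds _ _, Complex.ofReal_exp, add_mul, Finset.sum_add_distrib, mul_ite,
      ite_mul, mul_one, mul_zero, zero_mul, Finset.sum_ite_eq', Finset.mem_univ, if_true,
      Finset.mul_sum]
    rw [add_comm]
    congr 1
    · exact Finset.sum_congr rfl fun _ _ => by ring
    · ring
  simp only [chernCurv]
  simp only [dZbar_congr j (h1 _), hGG.self_of_nhds _ _]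
  have h2 : ∀ m, dZbar j (fun w => chernGamma G w i k m +
      dZ i (fun w => (F w : ℂ)) w * (if m = k then 1 else 0)) z =
      dZbar j (fun w => chernGamma G w i k m) z + (if m = k then
        levi (fderiv ℝ (fderiv ℝ fun w => (F w : ℂ)) z) (unitVec i) (unitVec j) else 0) := by
    intro m
    rw [dZbar_add j (h.differentiableAt_chernGamma i k m) ((fderiv_dZ i hFC).1.mul_const _)]
    congr 1
    split_ifs
    · simp only [mul_one]
      exact dZbar_dZ i j hFC
    · simp [dZbar]
  simp only [h2, neg_add, add_mul, Finset.sum_add_distrib, mul_sub, Finset.mul_sum]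
  rw [sub_eq_add_neg]
  congr 1
  · exact Finset.sum_congr rfl fun _ _ => by ring
  · simp only [neg_mul, ite_mul, zero_mul, Finset.sum_neg_distrib, Finset.sum_ite_eq',
      Finset.mem_univ, if_true]
    ring

/-! ### `Q`-nonnegativity at a point -/

theorem sesquilinear_apply {n : ℕ} (φ : Cn n →ₗ[ℂ] Cn n →ₗ⋆[ℂ] ℂ) (u v : Cn n) :
    φ u v = ∑ i, ∑ j, φ (unitVec i) (unitVec j) * u i * conj (v j) := by
  conv_lhs => rw [← sum_smul_unitVec u, ← sum_smul_unitVec v]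
  simp only [map_sum, LinearMap.sum_apply, map_smul, map_smulₛₗ, LinearMap.smul_apply, smul_eq_mul,
    Finset.mul_sum]
  rw [Finset.sum_comm]
  exact Finset.sum_congr rfl fun _ _ => Finset.sum_congr rfl fun _ _ => by ring

/-! ### Evaluating 4-tensors on pairs of vectors. -/

theorem evalDiag_mul {n : ℕ} (A B : Matrix (Fin n) (Fin n) ℂ) (u v : Cn n) :
    evalDiag (fun i j k l => A i j * B k l) u v = sesq A u u * sesq B v v := by
  simp only [evalDiag, sesq_apply, Finset.sum_mul]
  refine Finset.sum_congr rfl fun i _ => Finset.sum_congr rfl fun j _ => ?_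
  simp only [Finset.mul_sum]
  exact Finset.sum_congr rfl fun _ _ => Finset.sum_congr rfl fun _ _ => by ring

theorem evalDiag_sub {n : ℕ} (A B : Fin n → Fin n → Fin n → Fin n → ℂ) (u v : Cn n) :
    evalDiag (fun i j k l => A i j k l - B i j k l) u v = evalDiag A u v - evalDiag B u v := by
  simp only [evalDiag, sub_mul, Finset.sum_sub_distrib]

theorem evalDiag_const_mul {n : ℕ} (c : ℂ) (A : Fin n → Fin n → Fin n → Fin n → ℂ) (u v : Cn n) :
    evalDiag (fun i j k l => c * A i j k l) u v = c * evalDiag A u v := by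
  simp only [evalDiag, mul_assoc, Finset.mul_sum]

theorem evalDiag_real_smul {n : ℕ} (A : Fin n → Fin n → Fin n → Fin n → ℂ) (r : ℝ) (u v : Cn n) :
    evalDiag A (r • u) (r • v) = (r ^ 4 : ℝ) * evalDiag A u v := by
  simp only [evalDiag, Finset.mul_sum]
  refine Finset.sum_congr rfl fun i _ => Finset.sum_congr rfl fun j _ =>
    Finset.sum_congr rfl fun k _ => Finset.sum_congr rfl fun l _ => ?_
  simp only [PiLp.smul_apply, Complex.real_smul, map_mul, Complex.conj_ofReal]
  push_cast
  ring

theorem sesq_eq_sum_left {n : ℕ} (A : Matrix (Fin n) (Fin n) ℂ) (u v : Cn n) :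
    sesq A u v = ∑ k, u k * sesq A (unitVec k) v := by
  conv_lhs => rw [← sum_smul_unitVec u]
  simp only [map_sum, LinearMap.sum_apply, map_smul, LinearMap.smul_apply, smul_eq_mul]

theorem evalDiag_mul_conj {n : ℕ} (c : ℂ) (A B : Matrix (Fin n) (Fin n) ℂ) (u v : Cn n) :
    evalDiag (fun i j k l => c * A k j * conj (B l i)) u v =
      c * sesq A v u * conj (sesq B v u) := by
  calc _ = ∑ i, ∑ k, ∑ l, ∑ j, c * A k j * conj (B l i) * u i * conj (u j) * v k * conj (v l) := by
        refine Finset.sum_congr rfl fun i _ => ?_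
        rw [Finset.sum_comm]
        exact Finset.sum_congr rfl fun k _ => Finset.sum_comm
    _ = ∑ l, ∑ i, ∑ k, ∑ j, c * A k j * conj (B l i) * u i * conj (u j) * v k * conj (v l) := by
        exact (Finset.sum_congr rfl fun i _ => Finset.sum_comm).trans Finset.sum_comm
    _ = _ := by
        rw [sesq_apply B, map_sum, Finset.mul_sum]
        refine Finset.sum_congr rfl fun l _ => ?_
        rw [map_sum, Finset.mul_sum]
        refine Finset.sum_congr rfl fun i _ => ?_
        rw [sesq_apply A, Finset.mul_sum, Finset.sum_mul]
        refine Finset.sum_congr rfl fun k _ => ?_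
        rw [Finset.mul_sum, Finset.sum_mul]
        refine Finset.sum_congr rfl fun j _ => ?_
        simp only [map_mul, Complex.conj_conj]
        ring

theorem evalDiag_sum {n : ℕ} {ι : Type*} (s : Finset ι)
    (A : ι → Fin n → Fin n → Fin n → Fin n → ℂ) (u v : Cn n) :
    evalDiag (fun i j k l => ∑ p ∈ s, A p i j k l) u v = ∑ p ∈ s, evalDiag (A p) u v := by
  simp only [evalDiag, Finset.sum_mul]
  symm
  rw [Finset.sum_comm]
  refine Finset.sum_congr rfl fun i _ => ?_
  rw [Finset.sum_comm]
  refine Finset.sum_congr rfl fun j _ => ?_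
  rw [Finset.sum_comm]
  exact Finset.sum_congr rfl fun k _ => Finset.sum_comm

theorem LeeAt.chernTorsionLow_eq {n : ℕ} {G : MetricField n} {z : Cn n} {l : Cn n →ₗ[ℝ] ℝ}
    (h : HermitianAt G z) (hL : LeeAt G z l) {X : Cn n}
    (hX : ∀ d, 2 * (sesq (G z) X d).re = l d) (k p j : Fin n) :
    chernTorsionLow G z k p j =
      sesq (G z) (unitVec k) X * G z p j - sesq (G z) (unitVec p) X * G z k j := by
  have hc := h.herm.self_of_nhds
  -- The (1,0)-part of ℓ is h(·, X): this is why the torsion of a locally conformally Kähler metric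
  -- is expressed through X.
  have hl : ∀ u, (l u - Complex.I * l (Complex.I • u) : ℂ) = 2 * sesq (G z) u X := by
    intro u
    rw [← hX, ← hX, sesq_re_comm hc X, sesq_re_comm hc X, sesq_I_left]
    apply Complex.ext <;> simp
  have h1 := hL.torsion h.herm (unitVec k) (unitVec p) (unitVec j)
  rw [hl, hl] at h1
  simp only [chernTorsionLow, chernTorsion, sub_mul, Finset.sum_sub_distrib,
    sum_chernGamma_mul h.isUnit, dZ_eq_dMat]
  simp only [sesq_unitVec] at h1 ⊢
  linear_combination (1 / 2) * h1

/-- Raising the index of the covector h(e_p, u) with the inverse metric recovers the conjugate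
components of u. -/
theorem sum_invMetric_mul {n : ℕ} {G : MetricField n} {z : Cn n} (h : IsUnit (G z)) (u : Cn n) :
    ∑ p, ∑ q, invMetric G z p q * sesq (G z) (unitVec p) u * conj (sesq (G z) (unitVec q) u) =
      conj (sesq (G z) u u) := by
  have hdet := (Matrix.isUnit_iff_isUnit_det _).1 h
  have h1 : ∀ q, ∑ p, invMetric G z p q * sesq (G z) (unitVec p) u = conj (u q) := by
    intro q
    have h2 : (fun p => sesq (G z) (unitVec p) u) = (G z).mulVec fun j => conj (u j) := by
      ext p
      rw [sesq_unitVec_left]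
      rfl
    change ((G z)⁻¹.mulVec fun p => sesq (G z) (unitVec p) u) q = _
    rw [h2, Matrix.mulVec_mulVec, Matrix.nonsing_inv_mul _ hdet, Matrix.one_mulVec]
  rw [Finset.sum_comm]
  simp only [← Finset.sum_mul, h1]
  rw [sesq_eq_sum_left _ u u, map_sum]
  simp only [map_mul]

/-- When h(v,u) = 0 only one of the two torsion terms survives, T(v, e_p, ū) = h(v,X) h(e_p,u), and
contracting it with its conjugate gives |h(v,X)|² times the conjugate of h(u,u). -/
theorem evalDiag_tensorQ {n : ℕ} {G : MetricField n} {z : Cn n} {l : Cn n →ₗ[ℝ] ℝ}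
    (h : HermitianAt G z) (hL : LeeAt G z l) {X : Cn n}
    (hX : ∀ d, 2 * (sesq (G z) X d).re = l d) {u v : Cn n} (huv : sesq (G z) v u = 0) :
    evalDiag (tensorQ G z) u v = evalDiag (chernCurv G z) u v -
      Complex.normSq (sesq (G z) v X) * conj (sesq (G z) u u) := by
  have h1 : ∀ p, sesq (fun k j => chernTorsionLow G z k p j) v u =
      sesq (G z) v X * sesq (G z) (unitVec p) u := by
    intro p
    have h2 : sesq (fun k j => chernTorsionLow G z k p j) v u =
        sesq (G z) v X * sesq (G z) (unitVec p) u -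
          sesq (G z) (unitVec p) X * sesq (G z) v u := by
      rw [sesq_eq_sum_left _ v X, sesq_unitVec_left (G z) p u, Finset.sum_mul_sum]
      simp only [hL.chernTorsionLow_eq h hX, sesq_apply (fun _ _ => _)]
      rw [sesq_apply (G z) v u]
      simp only [Finset.mul_sum, ← Finset.sum_sub_distrib]
      exact Finset.sum_congr rfl fun _ _ => Finset.sum_congr rfl fun _ _ => by ring
    rw [h2, huv, mul_zero, sub_zero]
  have h3 : evalDiag (fun i j k l => ∑ p, ∑ q, invMetric G z p q * chernTorsionLow G z k p j *
      conj (chernTorsionLow G z l q i)) u v =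
      Complex.normSq (sesq (G z) v X) * conj (sesq (G z) u u) := by
    rw [← sum_invMetric_mul h.isUnit u, Finset.mul_sum, evalDiag_sum]
    refine Finset.sum_congr rfl fun p _ => ?_
    rw [Finset.mul_sum, evalDiag_sum]
    refine Finset.sum_congr rfl fun q _ => ?_
    rw [evalDiag_mul_conj (invMetric G z p q) (fun k j => chernTorsionLow G z k p j)
      (fun l i => chernTorsionLow G z l q i), h1, h1, map_mul, ← Complex.mul_conj]
    ring
  exact (evalDiag_sub _ _ u v).trans (congrArg _ h3)

/-- Expand the nonnegative square of the component of X orthogonal to u and v. -/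
theorem bessel_two {n : ℕ} {A : Matrix (Fin n) (Fin n) ℂ} (hA : ∀ i j, conj (A i j) = A j i)
    (hpos : ∀ u, u ≠ 0 → 0 < (sesq A u u).re) {u v : Cn n} (huu : sesq A u u = 1)
    (hvv : sesq A v v = 1) (huv : sesq A u v = 0) (X : Cn n) :
    Complex.normSq (sesq A u X) + Complex.normSq (sesq A v X) ≤ (sesq A X X).re := by
  have hvu : sesq A v u = 0 := by rw [← sesq_conj hA, huv, map_zero]
  set Y := X - sesq A X u • u - sesq A X v • v with hY
  have h0 : 0 ≤ (sesq A Y Y).re := by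
    by_cases h : Y = 0
    · simp [h]
    · exact (hpos Y h).le
  have h1 : sesq A Y Y = sesq A X X - Complex.normSq (sesq A u X) -
      Complex.normSq (sesq A v X) := by
    rw [hY, ← Complex.mul_conj, ← Complex.mul_conj, sesq_conj hA, sesq_conj hA]
    simp only [map_sub, LinearMap.sub_apply, map_smul, map_smulₛₗ, LinearMap.smul_apply,
      smul_eq_mul, huu, hvv, huv, hvu, sesq_conj hA]
    ring
  rw [h1] at h0
  simp only [Complex.sub_re, Complex.ofReal_re] at h0
  linarith

/-- Average the sum with its copy under k ↔ m. This converts the weights of the Q-condition into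
those of quadratic orthogonal bisectional curvature. -/
theorem sum_antisymmetrize {n : ℕ} {A : Fin n → Fin n → ℝ} (hA : ∀ k m, A k m = A m k)
    (lam : Fin n → ℝ) :
    ∑ k, ∑ m, A k m * (lam k ^ 2 - lam k * lam m) =
      (1 / 2) * ∑ k, ∑ m, A k m * (lam m - lam k) ^ 2 := by
  have h : ∑ k, ∑ m, A k m * (lam k ^ 2 - lam k * lam m) =
      ∑ k, ∑ m, A k m * (lam m ^ 2 - lam k * lam m) := by
    rw [Finset.sum_comm]
    exact Finset.sum_congr rfl fun _ _ => Finset.sum_congr rfl fun _ _ => by rw [hA]; ring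
  have h2 : ∑ k, ∑ m, A k m * (lam m - lam k) ^ 2 =
      ∑ k, ∑ m, A k m * (lam k ^ 2 - lam k * lam m) +
        ∑ k, ∑ m, A k m * (lam m ^ 2 - lam k * lam m) := by
    simp only [← Finset.sum_add_distrib]
    exact Finset.sum_congr rfl fun _ _ => Finset.sum_congr rfl fun _ _ => by ring
  linarith

theorem evalDiag_chernCurv_conformal {n : ℕ} {G G' : MetricField n} {F : Cn n → ℝ} {z : Cn n}
    (h : HermitianAt G z) (h' : HermitianAt G' z) (hF : ContDiffAt ℝ 2 F z)
    (hGG : ∀ᶠ w in 𝓝 z, ∀ i j, G' w i j = Real.exp (F w) * G w i j) (u v : Cn n) :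
    evalDiag (chernCurv G' z) u v = Real.exp (F z) * (evalDiag (chernCurv G z) u v -
      levi (fderiv ℝ (fderiv ℝ fun w => (F w : ℂ)) z) u u * sesq (G z) v v) := by
  have h1 : chernCurv G' z = fun i j k l => (Real.exp (F z) : ℂ) * (chernCurv G z i j k l -
      levi (fderiv ℝ (fderiv ℝ fun w => (F w : ℂ)) z) (unitVec i) (unitVec j) * G z k l) := by
    funext i j k l
    exact chernCurv_conformal h h' hF hGG i j k l
  have h2 : evalDiag (fun i j k l => levi (fderiv ℝ (fderiv ℝ fun w => (F w : ℂ)) z)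
      (unitVec i) (unitVec j) * G z k l) u v =
      levi (fderiv ℝ (fderiv ℝ fun w => (F w : ℂ)) z) u u * sesq (G z) v v := by
    rw [sesquilinear_apply (levi _) u u]
    exact evalDiag_mul _ _ _ _
  rw [h1, evalDiag_const_mul]
  congr 1
  exact (evalDiag_sub _ _ _ _).trans (congrArg _ h2)

/-- Scaling a G-unitary frame by r = e^{-c/2} makes it G'-unitary. Every curvature term acquires the
same positive factor r⁴, so the sign is unaffected. -/
theorem quadratic_nonneg_of_conformal {n : ℕ} {G G' : MetricField n} {c : ℝ} {z : Cn n}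
    (hGG : ∀ i j, G' z i j = Real.exp c * G z i j)
    {A : Fin n → Fin n → Fin n → Fin n → ℂ}
    (hR : ∀ ε : Fin n → Cn n, IsUnitaryFrame G' z ε → ∀ lam : Fin n → ℝ,
      0 ≤ ∑ k, ∑ m, (evalDiag A (ε m) (ε k)).re * (lam m - lam k) ^ 2)
    {ε : Fin n → Cn n} (hε : IsUnitaryFrame G z ε) (lam : Fin n → ℝ) :
    0 ≤ ∑ k, ∑ m, (evalDiag A (ε m) (ε k)).re * (lam m - lam k) ^ 2 := by
  set r := Real.exp (-c / 2) with hr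
  have hr2 : r * (r * Real.exp c) = 1 := by
    rw [hr, ← Real.exp_add, ← Real.exp_add, ← Real.exp_zero]
    congr 1
    ring
  have hr0 : 0 < r := Real.exp_pos _
  have hG : ∀ u v, sesq (G' z) u v = Real.exp c * sesq (G z) u v := by
    intro u v
    simp only [sesq_apply, hGG, mul_assoc, ← Finset.mul_sum]
  have h2 := hR (fun k => r • ε k) (fun k m => by
    rw [herm_eq_sesq, sesq_real_smul_left, sesq_real_smul_right, ← hε k m, herm_eq_sesq, hG]
    have : (r : ℂ) * (r * Real.exp c) = 1 := by exact_mod_cast hr2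
    linear_combination sesq (G z) (ε k) (ε m) * this) lam
  simp only [evalDiag_real_smul, Complex.re_ofReal_mul, mul_assoc, ← Finset.mul_sum] at h2
  exact nonneg_of_mul_nonneg_right h2 (by positivity)

/-- Pointwise criterion: a metric with parallel Lee form `-dF`,
conformal to a Kähler metric `e^F G` with nonnegative quadratic orthogonal bisectional curvature,
is `Q`-nonnegative. -/
theorem tensorQ_sum_nonneg {n : ℕ} {G G' : MetricField n} {F : Cn n → ℝ} {z X : Cn n}
    (h : HermitianAt G z) (h' : HermitianAt G' z) (hF : ContDiffAt ℝ 2 F z)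
    (hGG : ∀ᶠ w in 𝓝 z, ∀ i j, G' w i j = Real.exp (F w) * G w i j)
    (hK : ∀ᶠ w in 𝓝 z, LeeAt G' w 0)
    (hX : ∀ d, 2 * (sesq (G z) X d).re = (-(fderiv ℝ F z : Cn n →ₗ[ℝ] ℝ)) d)
    (hL : LeeAt G z (-(fderiv ℝ F z : Cn n →ₗ[ℝ] ℝ))) (hP : ParallelAt G F z X)
    (hR : ∀ ε : Fin n → Cn n, IsUnitaryFrame G' z ε → ∀ lam : Fin n → ℝ,
      0 ≤ ∑ k, ∑ m, (evalDiag (chernCurv G' z) (ε m) (ε k)).re * (lam m - lam k) ^ 2)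
    {ε : Fin n → Cn n} (hε : IsUnitaryFrame G z ε) (lam : Fin n → ℝ) :
    0 ≤ ∑ k, ∑ m, (evalDiag (tensorQ G z) (ε m) (ε k)).re * (lam k ^ 2 - lam k * lam m) := by
  have hc := h.herm.self_of_nhds
  have hp := h.pos.self_of_nhds
  set E := Real.exp (F z) with hE
  have hE0 : 0 < E := Real.exp_pos _
  set S := (sesq (G z) X X).re
  set a : Fin n → ℝ := fun k => Complex.normSq (sesq (G z) (ε k) X) with ha
  have hon : ∀ k, sesq (G z) (ε k) (ε k) = 1 := fun k => (hε k k).trans (if_pos rfl)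
  have hort : ∀ k m, k ≠ m → sesq (G z) (ε k) (ε m) = 0 := fun k m h => (hε k m).trans (if_neg h)
  -- The Levi form of F contributes S - a m, while the torsion subtracts a k.
  have hQ : ∀ k m, k ≠ m → (evalDiag (tensorQ G z) (ε m) (ε k)).re =
      E⁻¹ * (evalDiag (chernCurv G' z) (ε m) (ε k)).re + (S - a m - a k) := by
    intro k m hkm
    rw [evalDiag_tensorQ h hL hX (hort k m hkm), evalDiag_chernCurv_conformal h h' hF hGG, levi_ofReal_self hF,
      complexHessian_of_parallel h.herm hX hL hP, hon, hon]
    simp only [Complex.re_ofReal_mul, Complex.sub_re, map_one, mul_one, Complex.ofReal_re,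
      Complex.one_re, ha, S]
    field_simp
    ring
  have hsum : ∑ k, ∑ m, (evalDiag (tensorQ G z) (ε m) (ε k)).re * (lam k ^ 2 - lam k * lam m) =
      E⁻¹ * ∑ k, ∑ m, (evalDiag (chernCurv G' z) (ε m) (ε k)).re *
        (lam k ^ 2 - lam k * lam m) +
      ∑ k, ∑ m, (S - a m - a k) * (lam k ^ 2 - lam k * lam m) := by
    simp only [Finset.mul_sum, ← Finset.sum_add_distrib]
    refine Finset.sum_congr rfl fun k _ => Finset.sum_congr rfl fun m _ => ?_
    -- The formula for Q needs orthogonal vectors; on the diagonal the weight vanishes, so no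
    -- formula is required.
    by_cases hkm : k = m
    · subst hkm
      ring
    · rw [hQ k m hkm]
      ring
  rw [hsum, sum_antisymmetrize (A := fun k m => (evalDiag (chernCurv G' z) (ε m) (ε k)).re)
      (fun k m => by rw [evalDiag_comm (h'.chernCurv_symm hK)]),
    sum_antisymmetrize (A := fun k m => S - a m - a k) (fun k m => by ring)]
  have h1 : 0 ≤ ∑ k, ∑ m, (evalDiag (chernCurv G' z) (ε m) (ε k)).re * (lam m - lam k) ^ 2 :=
    quadratic_nonneg_of_conformal hGG.self_of_nhds hR hε lam
  have h3 : 0 ≤ ∑ k, ∑ m, (S - a m - a k) * (lam m - lam k) ^ 2 := by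
    refine Finset.sum_nonneg fun k _ => Finset.sum_nonneg fun m _ => ?_
    by_cases hkm : k = m
    · subst hkm
      simp
    · refine mul_nonneg ?_ (sq_nonneg _)
      have := bessel_two hc hp (hon k) (hon m) (hort k m hkm) X
      simp only [ha, S]
      linarith
  exact add_nonneg (mul_nonneg (inv_pos.2 hE0).le (mul_nonneg (by norm_num) h1))
    (mul_nonneg (by norm_num) h3)

/-! ### Conformal changes and the Lee form -/

/-- By Leibniz, d(e^F ω) = e^F (dF ∧ ω + dω), and the exponential can be cancelled. -/
theorem LeeAt.of_conformal {n : ℕ} {G G' : MetricField n} {F : Cn n → ℝ} {z : Cn n}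
    (hG : ∀ i j, DifferentiableAt ℝ (fun w => G w i j) z) (hF : DifferentiableAt ℝ F z)
    (hGG : ∀ᶠ w in 𝓝 z, ∀ i j, G' w i j = Real.exp (F w) * G w i j) (hK : LeeAt G' z 0) :
    LeeAt G z (-(fderiv ℝ F z : Cn n →ₗ[ℝ] ℝ)) := by
  have hd : ∀ u v w, sesq (dMat G' z u) v w =
      Real.exp (F z) * (fderiv ℝ F z u * sesq (G z) v w + sesq (dMat G z u) v w) := by
    intro u v w
    have h1 : ∀ i j, dMat G' z u i j =
        Real.exp (F z) * (fderiv ℝ F z u * G z i j + dMat G z u i j) := by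
      intro i j
      have h2 : HasFDerivAt (fun w => (Real.exp (F w) : ℂ))
          (Complex.ofRealCLM.comp (Real.exp (F z) • fderiv ℝ F z)) z :=
        Complex.ofRealCLM.hasFDerivAt.comp z hF.hasFDerivAt.exp
      rw [dMat, Filter.EventuallyEq.fderiv_eq (hGG.mono fun w hw => hw i j),
        (h2.fun_mul (hG i j).hasFDerivAt).fderiv]
      simp [dMat]
      ring
    simp only [sesq_apply, h1, Finset.mul_sum, ← Finset.sum_add_distrib]
    exact Finset.sum_congr rfl fun _ _ => Finset.sum_congr rfl fun _ _ => by ring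
  intro u v w
  have h := hK u v w
  simp only [hd, LinearMap.zero_apply, zero_mul, add_zero, Complex.add_im,
    Complex.im_ofReal_mul] at h
  have h3 := mul_left_cancel₀ (Real.exp_pos (F z)).ne'
    ((by rw [mul_zero, ← h]; ring :
      Real.exp (F z) * (fderiv ℝ F z u * (sesq (G z) v w).im + (sesq (dMat G z u) v w).im +
        (fderiv ℝ F z v * (sesq (G z) w u).im + (sesq (dMat G z v) w u).im) +
        (fderiv ℝ F z w * (sesq (G z) u v).im + (sesq (dMat G z w) u v).im)) =
      Real.exp (F z) * 0))
  simp only [Complex.add_im, LinearMap.neg_apply, ContinuousLinearMap.coe_coe]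
  linear_combination h3

/-- In dimension at least two, every u has a nonzero h-orthogonal v. On (u, v, Iv) the form ℓ ∧ ω
reduces to a nonzero multiple of ℓ(u). -/
theorem LeeAt.unique {n : ℕ} (hn : 2 ≤ n) {G : MetricField n} {z : Cn n} {l l' : Cn n →ₗ[ℝ] ℝ}
    (hc : ∀ i j, conj (G z i j) = G z j i) (hpos : ∀ u, u ≠ 0 → 0 < (sesq (G z) u u).re)
    (h : LeeAt G z l) (h' : LeeAt G z l') : l = l' := by
  ext u
  have hker : LinearMap.ker (((sesq (G z)).flip u : Cn n →ₗ[ℂ] ℂ)) ≠ ⊥ := by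
    apply LinearMap.ker_ne_bot_of_finrank_lt
    rw [Module.finrank_self, finrank_euclideanSpace_fin]
    omega
  obtain ⟨v, hv, hv0⟩ := Submodule.exists_mem_ne_zero_of_ne_bot hker
  have hvu : sesq (G z) v u = 0 := hv
  have huv : sesq (G z) u v = 0 := by rw [← sesq_conj hc, hvu, map_zero]
  have h1 := (h u v (Complex.I • v)).symm.trans (h' u v (Complex.I • v))
  simp only [sesq_I_left, sesq_I_right, huv, hvu, mul_zero, Complex.zero_im, add_zero,
    Complex.mul_im, Complex.neg_re, Complex.neg_im, Complex.I_re, Complex.I_im] at h1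
  have h2 := hpos v hv0
  have h3 : (l u - l' u) * (sesq (G z) v v).re = 0 := by linear_combination -h1
  exact sub_eq_zero.1 ((mul_eq_zero.1 h3).resolve_right h2.ne')

/-- The conformal factor of a Kähler cover is given as a bare function. Its regularity follows by
writing F as the logarithm of a quotient of positive diagonal components of the two metrics. -/
theorem contDiffAt_log_ratio {n : ℕ} {G G' : MetricField n} {F : Cn n → ℝ} {z : Cn n}
    (h : HermitianAt G z) (h' : HermitianAt G' z) (i : Fin n)
    (hGG : ∀ᶠ w in 𝓝 z, ∀ i j, G' w i j = Real.exp (F w) * G w i j) : ContDiffAt ℝ 2 F z := by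
  have hi : (unitVec i : Cn n) ≠ 0 := fun h => by
    simpa [unitVec_apply] using congrArg (fun v : Cn n => v i) h
  have hre : ∀ H : MetricField n, HermitianAt H z → ContDiffAt ℝ 2 (fun w => (H w i i).re) z :=
    fun H hH => Complex.reCLM.contDiff.contDiffAt.comp z (hH.contDiff i i)
  have hp : ∀ H : MetricField n, HermitianAt H z → ∀ᶠ w in 𝓝 z, 0 < (H w i i).re :=
    fun H hH => hH.pos.mono fun w hw => by simpa only [sesq_unitVec] using hw _ hi
  have h1 : F =ᶠ[𝓝 z] fun w => Real.log (G' w i i).re - Real.log (G w i i).re := by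
    filter_upwards [hp G h, hGG] with w h1 h3
    rw [h3, Complex.re_ofReal_mul, Real.log_mul (Real.exp_pos _).ne' h1.ne', Real.log_exp]
    ring
  exact (((hre G' h').log (hp G' h').self_of_nhds.ne').sub
    ((hre G h).log (hp G h).self_of_nhds.ne')).congr_of_eventuallyEq h1

theorem tensorQ_sum_nonneg_of_leeForm {n : ℕ} (hn : 2 ≤ n) {G G' : MetricField n}
    {F : Cn n → ℝ} {z : Cn n} (h : HermitianAt G z) (h' : HermitianAt G' z)
    (hGG : ∀ᶠ w in 𝓝 z, ∀ i j, G' w i j = Real.exp (F w) * G w i j)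
    {θ : CovectorField n} {l : Cn n → Cn n →ₗ[ℝ] ℝ} (hl : ∀ w a, θ w a = l w (realVec a))
    (hL : ∀ᶠ w in 𝓝 z, LeeAt G w (l w)) (hP : ∀ a b, nablaCovector G θ z a b = 0)
    (hK : ∀ᶠ w in 𝓝 z, LeeAt G' w 0)
    (hR : ∀ ε : Fin n → Cn n, IsUnitaryFrame G' z ε → ∀ lam : Fin n → ℝ,
      0 ≤ ∑ k, ∑ m, (evalDiag (chernCurv G' z) (ε m) (ε k)).re * (lam m - lam k) ^ 2)
    {ε : Fin n → Cn n} (hε : IsUnitaryFrame G z ε) (lam : Fin n → ℝ) :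
    0 ≤ ∑ k, ∑ m, (evalDiag (tensorQ G z) (ε m) (ε k)).re * (lam k ^ 2 - lam k * lam m) := by
  have hF : ContDiffAt ℝ 2 F z := contDiffAt_log_ratio h h' ⟨0, by omega⟩ hGG
  -- Uniqueness identifies θ with -dF throughout a neighbourhood, as needed for the covariant
  -- derivative.
  have hlF : ∀ᶠ w in 𝓝 z, l w = -(fderiv ℝ F w : Cn n →ₗ[ℝ] ℝ) := by
    filter_upwards [h.eventually, hF.eventually (by simp), hGG.eventually_nhds, hL, hK]
      with w hw hFw hGw hLw hKw
    exact LeeAt.unique hn hw.herm.self_of_nhds hw.pos.self_of_nhds hLw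
      (hKw.of_conformal hw.differentiableAt (hFw.differentiableAt (by norm_num)) hGw)
  have hθ : ∀ᶠ w in 𝓝 z, ∀ a, θ w a = -fderiv ℝ F w (realVec a) :=
    hlF.mono fun w hw a => by rw [hl, hw]; rfl
  obtain ⟨X, hX⟩ := exists_dual h.pos.self_of_nhds (-(fderiv ℝ F z : Cn n →ₗ[ℝ] ℝ))
  have hFd : DifferentiableAt ℝ (fderiv ℝ F) z :=
    (hF.fderiv_right (m := 1) (by norm_num)).differentiableAt (by norm_num)
  exact tensorQ_sum_nonneg h h' hF hGG hK hX (hlF.self_of_nhds ▸ hL.self_of_nhds)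
    ((parallelAt_iff h.differentiableAt h.pos.self_of_nhds hFd hθ hX).1 hP) hR hε lam

/-! ### Coordinates on complex manifolds -/

theorem mdifferentiable_of_mem_holoCharts {n : ℕ} {M : Type*} [TopologicalSpace M]
    [ChartedSpace (Cn n) M] [IsManifold 𝓘(ℂ, Cn n) ω M] {e : OpenPartialHomeomorph M (Cn n)}
    (he : e ∈ holoCharts n M) : e.MDifferentiable 𝓘(ℂ, Cn n) 𝓘(ℂ, Cn n) :=
  ⟨(contMDiffOn_of_mem_maximalAtlas he).mdifferentiableOn (by simp),
    (contMDiffOn_symm_of_mem_maximalAtlas he).mdifferentiableOn (by simp)⟩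

theorem tangentOf_add {n : ℕ} {M : Type*} [TopologicalSpace M] [ChartedSpace (Cn n) M]
    (e : OpenPartialHomeomorph M (Cn n)) (z u v : Cn n) :
    tangentOf e z (u + v) = tangentOf e z u + tangentOf e z v :=
  (mfderiv 𝓘(ℂ, Cn n) 𝓘(ℂ, Cn n) e.symm z).map_add u v

theorem tangentOf_smul {n : ℕ} {M : Type*} [TopologicalSpace M] [ChartedSpace (Cn n) M]
    (e : OpenPartialHomeomorph M (Cn n)) (z : Cn n) (c : ℂ) (u : Cn n) :
    tangentOf e z (c • u) = c • tangentOf e z u :=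
  (mfderiv 𝓘(ℂ, Cn n) 𝓘(ℂ, Cn n) e.symm z).map_smul c u

theorem tangentOf_ne_zero {n : ℕ} {M : Type*} [TopologicalSpace M]
    [ChartedSpace (Cn n) M] [IsManifold 𝓘(ℂ, Cn n) ω M] {e : OpenPartialHomeomorph M (Cn n)}
    (he : e ∈ holoCharts n M) {z : Cn n} (hz : z ∈ e.target) {u : Cn n} (hu : u ≠ 0) :
    tangentOf e z u ≠ 0 := fun h =>
  hu ((mdifferentiable_of_mem_holoCharts he).symm.mfderiv_injective hz
    (h.trans (ContinuousLinearMap.map_zero _).symm))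

theorem HermitianMetric.sesq_coord {n : ℕ} {M : Type*} [TopologicalSpace M]
    [ChartedSpace (Cn n) M] (g : HermitianMetric n M) (e : OpenPartialHomeomorph M (Cn n))
    (z u v : Cn n) :
    sesq (g.coord e z) u v = g.form (e.symm z) (tangentOf e z u) (tangentOf e z v) := by
  let φ : Cn n →ₗ[ℂ] Cn n →ₗ⋆[ℂ] ℂ := LinearMap.mk₂'ₛₗ (RingHom.id ℂ) (starRingEnd ℂ)
    (fun u v => g.form (e.symm z) (tangentOf e z u) (tangentOf e z v))
    (fun u u' v => by rw [tangentOf_add, map_add, LinearMap.add_apply])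
    (fun c u v => by rw [tangentOf_smul, map_smul]; rfl)
    (fun u v v' => by rw [tangentOf_add, map_add])
    (fun c u v => by rw [tangentOf_smul, map_smulₛₗ])
  exact (sesquilinear_apply φ u v).symm

theorem HermitianMetric.hermitianAt_coord {n : ℕ} {M : Type*} [TopologicalSpace M]
    [ChartedSpace (Cn n) M] [IsManifold 𝓘(ℂ, Cn n) ω M] (g : HermitianMetric n M)
    {e : OpenPartialHomeomorph M (Cn n)} (he : e ∈ holoCharts n M) {z : Cn n}
    (hz : z ∈ e.target) : HermitianAt (g.coord e) z where
  contDiff i j :=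
    ((g.smooth e he i j).contDiffAt (e.open_target.mem_nhds hz)).of_le ENat.LEInfty.out
  herm := Filter.Eventually.of_forall fun w i j => g.conj_symm _ _ _
  pos := by
    filter_upwards [e.open_target.mem_nhds hz] with w hw u hu
    rw [g.sesq_coord]
    exact g.pos _ _ (tangentOf_ne_zero he hw hu)

/-- A real 1-form in a chart, as a field of linear forms. -/
noncomputable def RealOneForm.coordLinear {n : ℕ} {M : Type*} [TopologicalSpace M]
    [ChartedSpace (Cn n) M] (θ : RealOneForm n M) (e : OpenPartialHomeomorph M (Cn n)) (z : Cn n) :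
    Cn n →ₗ[ℝ] ℝ where
  toFun u := θ.form (e.symm z) (tangentOf e z u)
  map_add' u v := by rw [tangentOf_add, map_add]
  map_smul' r u := by
    rw [← Complex.coe_smul, tangentOf_smul, RingHom.id_apply, ← map_smul]
    congr 1

theorem HermitianMetric.leeAt_coord {n : ℕ} {M : Type*} [TopologicalSpace M]
    [ChartedSpace (Cn n) M] [IsManifold 𝓘(ℂ, Cn n) ω M] {g : HermitianMetric n M}
    {θ : RealOneForm n M} (hL : IsLeeForm g θ) {e : OpenPartialHomeomorph M (Cn n)}
    (he : e ∈ holoCharts n M) {z : Cn n} (hz : z ∈ e.target) :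
    LeeAt (g.coord e) z (θ.coordLinear e z) :=
  (leeAt_iff (g.hermitianAt_coord he hz).differentiableAt (fun _ => rfl)).1 (hL e he z hz).2

theorem HermitianMetric.leeAt_coord_of_kahler {n : ℕ} {M : Type*} [TopologicalSpace M]
    [ChartedSpace (Cn n) M] [IsManifold 𝓘(ℂ, Cn n) ω M] {g : HermitianMetric n M}
    (hK : IsKahler g) {e : OpenPartialHomeomorph M (Cn n)}
    (he : e ∈ holoCharts n M) {z : Cn n} (hz : z ∈ e.target) : LeeAt (g.coord e) z 0 :=
  (leeAt_iff (g.hermitianAt_coord he hz).differentiableAt (θ := fun _ _ => 0)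
    (fun _ => rfl)).1 fun a b c => by simp [hK e he z hz, wedgeFund]

/-- All tangent spaces are definitionally `Cn n`, so the same coordinate vectors can be used at
equal base points without a transport. -/
theorem HermitianMetric.form_congr {n : ℕ} {M : Type*} [TopologicalSpace M]
    [ChartedSpace (Cn n) M] (g : HermitianMetric n M) {x y : M} (h : x = y) (u v : Cn n) :
    g.form x u v = g.form y u v := by
  subst h
  rfl

/-- A local diffeomorphism is the identity in suitable holomorphic coordinates. -/
theorem exists_chart_comp {n : ℕ} {M N : Type*} [TopologicalSpace M]
    [ChartedSpace (Cn n) M] [IsManifold 𝓘(ℂ, Cn n) ω M] [TopologicalSpace N]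
    [ChartedSpace (Cn n) N] [IsManifold 𝓘(ℂ, Cn n) ω N] {π : N → M}
    (hπ : IsLocalDiffeomorph 𝓘(ℂ, Cn n) 𝓘(ℂ, Cn n) ω π)
    {e : OpenPartialHomeomorph M (Cn n)} (he : e ∈ holoCharts n M) {z : Cn n}
    (hz : z ∈ e.target) {x : N} (hx : π x = e.symm z) :
    ∃ e' ∈ holoCharts n N, z ∈ e'.target ∧
      ∀ w ∈ e'.target, w ∈ e.target ∧ π (e'.symm w) = e.symm w := by
  obtain ⟨Φ, hxΦ, hΦ⟩ := hπ x
  -- Precomposing the chart below with a local inverse branch of π makes π the identity in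
  -- coordinates, so the metrics upstairs and downstairs are compared as matrices at the same w.
  refine ⟨Φ.toOpenPartialHomeomorph ≫ₕ e, ?_, ?_, ?_⟩
  · rw [holoCharts, IsManifold.mem_maximalAtlas_iff_contMDiffOn]
    constructor
    · exact (contMDiffOn_of_mem_maximalAtlas he).comp (Φ.contMDiffOn_toFun.mono fun y hy => hy.1)
        fun y hy => hy.2
    · exact Φ.contMDiffOn_invFun.comp ((contMDiffOn_symm_of_mem_maximalAtlas he).mono
        fun y hy => hy.1) fun y hy => hy.2
  · refine ⟨hz, ?_⟩
    change e.symm z ∈ Φ.target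
    rw [← hx, hΦ hxΦ]
    exact Φ.map_source hxΦ
  · rintro w ⟨hw, hw'⟩
    refine ⟨hw, ?_⟩
    have hw' : e.symm w ∈ Φ.target := hw'
    exact (hΦ (Φ.map_target hw')).trans (Φ.right_inv hw')

theorem qNonneg_of_kahlerCover {n : ℕ} {M N : Type*} [TopologicalSpace M]
    [ChartedSpace (Cn n) M] [IsManifold 𝓘(ℂ, Cn n) ω M] [TopologicalSpace N]
    [ChartedSpace (Cn n) N] [IsManifold 𝓘(ℂ, Cn n) ω N] {π : N → M}
    {g : HermitianMetric n M} {g' : HermitianMetric n N} (hV : IsVaisman g)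
    (hC : IsKahlerCover π g g') (hR : NonnegQuadOrthBisectional g') : QNonneg g := by
  intro e he z hz ε hε lam
  -- In dimension at most one only k = m occurs and the sum is zero; the Lee form need not be unique
  -- there.
  rcases lt_or_ge n 2 with hn | hn
  · refine Finset.sum_nonneg fun k _ => Finset.sum_nonneg fun m _ => ?_
    obtain rfl : k = m := Fin.ext (by omega)
    exact le_of_eq (by ring)
  obtain ⟨θ, hL, hP⟩ := hV
  obtain ⟨x, hx⟩ := hC.surjective (e.symm z)
  obtain ⟨e', he', hz', hee⟩ := exists_chart_comp hC.holomorphic he hz hx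
  obtain ⟨f, hf⟩ := hC.conformal
  have htarget : ∀ᶠ w in 𝓝 z, w ∈ e'.target := e'.open_target.mem_nhds hz'
  -- Chain rule for π ∘ e'.symm = e.symm: π carries coordinate vectors to coordinate vectors with
  -- the same components.
  have htan : ∀ w ∈ e'.target, ∀ u : Cn n,
      mfderiv 𝓘(ℂ, Cn n) 𝓘(ℂ, Cn n) π (e'.symm w) (tangentOf e' w u) =
        (tangentOf e w u : Cn n) := by
    intro w hw u
    have h1 : MDifferentiableAt 𝓘(ℂ, Cn n) 𝓘(ℂ, Cn n) π (e'.symm w) :=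
      (hC.holomorphic _).mdifferentiableAt (by simp)
    have h2 := mfderiv_comp w h1
      ((mdifferentiable_of_mem_holoCharts he').mdifferentiableAt_symm hw)
    have h3 : π ∘ e'.symm =ᶠ[𝓝 w] e.symm := by
      filter_upwards [e'.open_target.mem_nhds hw] with y hy using (hee y hy).2
    have h4 := h3.mfderiv_eq (I := 𝓘(ℂ, Cn n)) (I' := 𝓘(ℂ, Cn n))
    exact congrArg (fun L : Cn n →L[ℂ] Cn n => L u) (h2.symm.trans h4)
  refine tensorQ_sum_nonneg_of_leeForm hn (g.hermitianAt_coord he hz)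
    (g'.hermitianAt_coord he' hz') (F := fun w => f (e'.symm w)) ?_ (l := θ.coordLinear e)
    (fun _ _ => rfl) ?_ (hP e he z hz) ?_ (hR e' he' z hz') hε lam
  · filter_upwards [htarget] with w hw i j
    refine (hf _ _ _).trans (congrArg _ ?_)
    refine (g.form_congr (hee w hw).2 _ _).trans ?_
    rw [htan w hw, htan w hw]
    rfl
  · filter_upwards [htarget] with w hw
    exact HermitianMetric.leeAt_coord hL he (hee w hw).1
  · filter_upwards [htarget] with w hw
    exact HermitianMetric.leeAt_coord_of_kahler hC.kahler he' hw

/-! ### The flat metric in arbitrary holomorphic coordinates -/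

theorem fderiv_real_eq {n : ℕ} {f : Cn n → Cn n} {z : Cn n} (hf : DifferentiableAt ℂ f z)
    (u : Cn n) : fderiv ℝ f z u = fderiv ℂ f z u := by
  rw [hf.fderiv_restrictScalars ℝ]; rfl

theorem fderiv_inner_holomorphic {n : ℕ} {f g : Cn n → Cn n} {z : Cn n}
    (hf : DifferentiableAt ℂ f z) (hg : DifferentiableAt ℂ g z) (u : Cn n) :
    fderiv ℝ (fun w => inner ℂ (f w) (g w)) z u =
      inner ℂ (f z) (fderiv ℂ g z u) + inner ℂ (fderiv ℂ f z u) (g z) := by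
  rw [fderiv_inner_apply ℂ (hf.restrictScalars ℝ) (hg.restrictScalars ℝ), fderiv_real_eq hf,
    fderiv_real_eq hg]

/-- The first slot of `inner` is conjugate-linear, so f enters antiholomorphically and ∂
differentiates only g. -/
theorem dZ_inner {n : ℕ} {f g : Cn n → Cn n} {z : Cn n}
    (hf : DifferentiableAt ℂ f z) (hg : DifferentiableAt ℂ g z) (i : Fin n) :
    dZ i (fun w => inner ℂ (f w) (g w)) z = inner ℂ (f z) (fderiv ℂ g z (unitVec i)) := by
  simp only [dZ, fderiv_inner_holomorphic hf hg, map_smul, inner_smul_left, inner_smul_right,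
    Complex.conj_I]
  linear_combination (-1 / 2 * inner ℂ (f z) (fderiv ℂ g z (unitVec i)) +
    1 / 2 * inner ℂ (fderiv ℂ f z (unitVec i)) (g z)) * Complex.I_sq

theorem dZbar_inner {n : ℕ} {f g : Cn n → Cn n} {z : Cn n}
    (hf : DifferentiableAt ℂ f z) (hg : DifferentiableAt ℂ g z) (i : Fin n) :
    dZbar i (fun w => inner ℂ (f w) (g w)) z = inner ℂ (fderiv ℂ f z (unitVec i)) (g z) := by
  simp only [dZbar, fderiv_inner_holomorphic hf hg, map_smul, inner_smul_left, inner_smul_right,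
    Complex.conj_I]
  linear_combination (1 / 2 * inner ℂ (f z) (fderiv ℂ g z (unitVec i)) -
    1 / 2 * inner ℂ (fderiv ℂ f z (unitVec i)) (g z)) * Complex.I_sq

/-- The pull-back of the flat metric of `ℂⁿ` by `φ`. -/
noncomputable def flatPullback {n : ℕ} (φ : Cn n → Cn n) : MetricField n := fun w i j =>
  inner ℂ (fderiv ℂ φ w (unitVec j)) (fderiv ℂ φ w (unitVec i))

/-- A holomorphic local coordinate change at `z`. -/
structure CoordChangeAt {n : ℕ} (φ : Cn n → Cn n) (z : Cn n) : Prop where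
  -- The pulled-back metric involves one derivative of φ and its curvature two more.
  contDiff : ContDiffAt ℂ 3 φ z
  injective : ∀ᶠ w in 𝓝 z, Function.Injective (fderiv ℂ φ w)

section FlatPullback

variable {n : ℕ} {φ : Cn n → Cn n} {z : Cn n}

theorem CoordChangeAt.eventually (h : CoordChangeAt φ z) : ∀ᶠ w in 𝓝 z, CoordChangeAt φ w := by
  filter_upwards [h.contDiff.eventually (by simp), h.injective.eventually_nhds] with w h1 h2
  exact ⟨h1, h2⟩

theorem CoordChangeAt.contDiffAt_fderiv (h : CoordChangeAt φ z) :
    ContDiffAt ℂ 2 (fderiv ℂ φ) z := h.contDiff.fderiv_right (by norm_num)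

theorem CoordChangeAt.differentiableAt_fderiv (h : CoordChangeAt φ z) (u : Cn n) :
    DifferentiableAt ℂ (fun w => fderiv ℂ φ w u) z :=
  ((ContinuousLinearMap.apply ℂ (Cn n) u).contDiff.contDiffAt.comp z
    h.contDiffAt_fderiv).differentiableAt (by norm_num)

theorem CoordChangeAt.fderiv_fderiv_apply (h : CoordChangeAt φ z) (u v : Cn n) :
    fderiv ℂ (fun w => fderiv ℂ φ w u) z v = fderiv ℂ (fderiv ℂ φ) z v u := by
  have h1 := h.contDiffAt_fderiv.differentiableAt (by norm_num)
  have h2 := ((ContinuousLinearMap.apply ℂ (Cn n) u).hasFDerivAt.comp z h1.hasFDerivAt).fderiv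
  exact congrArg (fun L : Cn n →L[ℂ] Cn n => L v) h2

theorem CoordChangeAt.symm (h : CoordChangeAt φ z) (u v : Cn n) :
    fderiv ℂ (fderiv ℂ φ) z u v = fderiv ℂ (fderiv ℂ φ) z v u :=
  h.contDiff.isSymmSndFDerivAt (by simp; norm_num) u v

theorem sesq_flatPullback (w u v : Cn n) :
    sesq (flatPullback φ w) u v = inner ℂ (fderiv ℂ φ w v) (fderiv ℂ φ w u) := by
  let B : Cn n →ₗ[ℂ] Cn n →ₗ⋆[ℂ] ℂ := LinearMap.mk₂'ₛₗ (RingHom.id ℂ) (starRingEnd ℂ)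
    (fun u v => inner ℂ (fderiv ℂ φ w v) (fderiv ℂ φ w u))
    (fun u u' v => by rw [map_add, inner_add_right])
    (fun c u v => by rw [map_smul, inner_smul_right]; rfl)
    (fun u v v' => by rw [map_add, inner_add_left])
    (fun c u v => by rw [map_smul, inner_smul_left]; rfl)
  exact (sesquilinear_apply B u v).symm

theorem CoordChangeAt.hermitianAt (h : CoordChangeAt φ z) : HermitianAt (flatPullback φ) z where
  contDiff i j := by
    have h1 : ∀ u, ContDiffAt ℝ 2 (fun w => fderiv ℂ φ w u) z := fun u =>
      ((ContinuousLinearMap.apply ℂ (Cn n) u).contDiff.contDiffAt.comp z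
        h.contDiffAt_fderiv).restrict_scalars ℝ
    exact (h1 _).inner ℂ (h1 _)
  herm := Filter.Eventually.of_forall fun w i j => inner_conj_symm _ _
  pos := by
    filter_upwards [h.injective] with w hw u hu
    rw [sesq_flatPullback]
    have : fderiv ℂ φ w u ≠ 0 := fun h0 => hu (hw (h0.trans (map_zero _).symm))
    exact (inner_self_nonneg (𝕜 := ℂ)).lt_of_ne' fun h0 => this (inner_self_eq_zero.1
      (Complex.ext h0 (inner_self_im (𝕜 := ℂ) _)))

theorem CoordChangeAt.sesq_dMat (h : CoordChangeAt φ z) (d u v : Cn n) :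
    sesq (dMat (flatPullback φ) z d) u v =
      inner ℂ (fderiv ℂ φ z v) (fderiv ℂ (fderiv ℂ φ) z d u) +
        inner ℂ (fderiv ℂ (fderiv ℂ φ) z d v) (fderiv ℂ φ z u) := by
  rw [← fderiv_herm h.hermitianAt.differentiableAt]
  simp only [herm_eq_sesq, sesq_flatPullback]
  rw [fderiv_inner_holomorphic (h.differentiableAt_fderiv _) (h.differentiableAt_fderiv _),
    h.fderiv_fderiv_apply, h.fderiv_fderiv_apply]

/-- Since D²φ is symmetric, the terms of the cyclic sum pair off into complex conjugates, whose
imaginary parts cancel. -/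
theorem CoordChangeAt.leeAt_zero (h : CoordChangeAt φ z) : LeeAt (flatPullback φ) z 0 := by
  intro u v w
  have him : ∀ x y : Cn n, (inner ℂ x y : ℂ).im = -(inner ℂ y x : ℂ).im := fun x y =>
    inner_im_symm (𝕜 := ℂ) x y
  simp only [h.sesq_dMat, Complex.add_im, LinearMap.zero_apply, zero_mul, add_zero]
  rw [h.symm v u, h.symm w u, h.symm w v, him (fderiv ℂ φ z w), him (fderiv ℂ φ z u),
    him (fderiv ℂ φ z v)]
  ring

theorem CoordChangeAt.chernCurv_eq_zero (h : CoordChangeAt φ z) (i j k l : Fin n) :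
    chernCurv (flatPullback φ) z i j k l = 0 := by
  have hdZ : ∀ i k l, ∀ w, CoordChangeAt φ w → dZ i (fun w => flatPullback φ w k l) w =
      inner ℂ (fderiv ℂ φ w (unitVec l)) (fderiv ℂ (fderiv ℂ φ) w (unitVec i) (unitVec k)) := by
    intro i k l w hw
    rw [← hw.fderiv_fderiv_apply]
    exact dZ_inner (hw.differentiableAt_fderiv _) (hw.differentiableAt_fderiv _) i
  have hsurj : Function.Surjective (fderiv ℂ φ z) :=
    LinearMap.surjective_of_injective (f := (fderiv ℂ φ z : Cn n →ₗ[ℂ] Cn n))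
      h.injective.self_of_nhds
  -- Dφ sends the connection coefficients Γ_{ik} to D²φ(e_i, e_k). Hence both terms of
  -- `HermitianAt.chernCurv_eq` are inner products of the same second derivatives and cancel.
  have hΓ : ∀ i k, ∑ m, chernGamma (flatPullback φ) z i k m • fderiv ℂ φ z (unitVec m) =
      fderiv ℂ (fderiv ℂ φ) z (unitVec i) (unitVec k) := by
    intro i k
    have h1 : ∀ l, inner ℂ (fderiv ℂ φ z (unitVec l))
        (∑ m, chernGamma (flatPullback φ) z i k m • fderiv ℂ φ z (unitVec m)) =
        inner ℂ (fderiv ℂ φ z (unitVec l)) (fderiv ℂ (fderiv ℂ φ) z (unitVec i) (unitVec k)) := by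
      intro l
      rw [← hdZ i k l z h, ← sum_chernGamma_mul h.hermitianAt.isUnit, inner_sum]
      exact Finset.sum_congr rfl fun m _ => inner_smul_right _ _ _
    refine ext_inner_left ℂ fun v => ?_
    obtain ⟨u, rfl⟩ := hsurj v
    rw [← sum_smul_unitVec u, map_sum, sum_inner, sum_inner]
    refine Finset.sum_congr rfl fun l _ => ?_
    rw [map_smul, inner_smul_left, inner_smul_left, h1]
  have hD : DifferentiableAt ℂ (fun w => fderiv ℂ (fderiv ℂ φ) w (unitVec i) (unitVec k)) z := by
    have h1 : ContDiffAt ℂ 1 (fderiv ℂ (fderiv ℂ φ)) z :=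
      h.contDiffAt_fderiv.fderiv_right (by norm_num)
    exact ((h1.differentiableAt (by norm_num)).clm_apply (differentiableAt_const _)).clm_apply
      (differentiableAt_const _)
  rw [h.hermitianAt.chernCurv_eq, ← dZbar_dZ i j (h.hermitianAt.contDiff k l),
    dZbar_congr j (h.eventually.mono fun w hw => hdZ i k l w hw),
    dZbar_inner (h.differentiableAt_fderiv _) hD, h.fderiv_fderiv_apply, ← hΓ i k, ← hΓ j l,
    sum_inner, neg_add_eq_zero, Finset.sum_comm]
  refine Finset.sum_congr rfl fun p _ => ?_
  rw [inner_sum]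
  refine Finset.sum_congr rfl fun m _ => ?_
  rw [inner_smul_left, inner_smul_right, flatPullback]
  ring

/-! ### The Hopf metric in arbitrary holomorphic coordinates -/

/-- The conformal factor between the flat metric and the Hopf metric. -/
noncomputable def hopfPotential (φ : Cn n → Cn n) (w : Cn n) : ℝ := Real.log (‖φ w‖ ^ 2 / 4)

theorem exp_hopfPotential {w : Cn n} (h : φ w ≠ 0) :
    Real.exp (hopfPotential φ w) = ‖φ w‖ ^ 2 / 4 :=
  Real.exp_log (by have := norm_pos_iff.2 h; positivity)

theorem hasFDerivAt_norm_sq_comp (hφ : DifferentiableAt ℂ φ z) :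
    DifferentiableAt ℝ (fun w => ‖φ w‖ ^ 2) z ∧
      ∀ u, fderiv ℝ (fun w => ‖φ w‖ ^ 2) z u = 2 * (inner ℂ (φ z) (fderiv ℂ φ z u)).re := by
  have h1 : (fun w => ‖φ w‖ ^ 2) = fun w => (inner ℂ (φ w) (φ w) : ℂ).re := by
    funext w
    exact (inner_self_eq_norm_sq (𝕜 := ℂ) (φ w)).symm
  have hd : DifferentiableAt ℝ (fun w => (inner ℂ (φ w) (φ w) : ℂ)) z :=
    (hφ.restrictScalars ℝ).inner ℂ (hφ.restrictScalars ℝ)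
  refine ⟨h1 ▸ Complex.reCLM.differentiableAt.comp z hd, fun u => ?_⟩
  rw [h1, fderiv_re hd, fderiv_inner_holomorphic hφ hφ, Complex.add_re]
  have := inner_re_symm (𝕜 := ℂ) (φ z) (fderiv ℂ φ z u)
  simp only [RCLike.re_eq_complex_re] at this
  linarith

theorem fderiv_hopfPotential (hφ : DifferentiableAt ℂ φ z) (h0 : φ z ≠ 0) (u : Cn n) :
    fderiv ℝ (hopfPotential φ) z u =
      2 * (inner ℂ (φ z) (fderiv ℂ φ z u)).re / ‖φ z‖ ^ 2 := by
  have hn := norm_pos_iff.2 h0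
  obtain ⟨h1, h2⟩ := hasFDerivAt_norm_sq_comp hφ
  have h3 := (h1.hasFDerivAt.mul_const (4⁻¹ : ℝ)).log (by positivity)
  have h4 : hopfPotential φ = fun w => Real.log (‖φ w‖ ^ 2 * 4⁻¹) := by
    funext w
    rw [hopfPotential, div_eq_mul_inv]
  rw [h4, h3.fderiv]
  simp only [smul_apply, smul_eq_mul, h2]
  field_simp

theorem contDiffAt_hopfPotential (hφ : ContDiffAt ℂ 3 φ z) (h0 : φ z ≠ 0) :
    ContDiffAt ℝ 2 (hopfPotential φ) z := by
  have hn := norm_pos_iff.2 h0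
  have h1 : ContDiffAt ℝ 2 φ z := (hφ.restrict_scalars ℝ).of_le (by norm_num)
  exact ((h1.norm_sq ℂ).div_const 4).log (by positivity)

/-- Differentiate |φ|² h = 4 h_flat as a product, which avoids derivatives of a quotient. -/
theorem CoordChangeAt.sesq_dMat_hopf (h : CoordChangeAt φ z) {G : MetricField n}
    (hGz : HermitianAt G z) (h0 : φ z ≠ 0)
    (hG : ∀ᶠ w in 𝓝 z, ∀ i j, G w i j = 4 * flatPullback φ w i j / (‖φ w‖ ^ 2 : ℝ))
    (d u v : Cn n) :
    ‖φ z‖ ^ 2 * (sesq (dMat G z d) u v).re =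
      4 * (sesq (dMat (flatPullback φ) z d) u v).re -
        fderiv ℝ (fun w => ‖φ w‖ ^ 2) z d * (sesq (G z) u v).re := by
  have hφ := h.contDiff.differentiableAt (by norm_num)
  have hne : ∀ᶠ w in 𝓝 z, φ w ≠ 0 := hφ.continuousAt.eventually_ne h0
  have h1 : (fun w => ‖φ w‖ ^ 2 * (herm G w u v).re) =ᶠ[𝓝 z]
      fun w => 4 * (herm (flatPullback φ) w u v).re := by
    filter_upwards [hG, hne] with w hw hne
    have hn := norm_pos_iff.2 hne
    have hs : herm G w u v = ((4 / ‖φ w‖ ^ 2 : ℝ) : ℂ) * herm (flatPullback φ) w u v := by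
      simp only [herm, hw, Finset.mul_sum]
      refine Finset.sum_congr rfl fun _ _ => Finset.sum_congr rfl fun _ _ => ?_
      push_cast
      ring
    rw [hs, Complex.re_ofReal_mul]
    field_simp
  have hre : ∀ H : MetricField n, HermitianAt H z →
      DifferentiableAt ℝ (fun w => (herm H w u v).re) z := fun H hH =>
    Complex.reCLM.differentiableAt.comp z (differentiableAt_herm hH.differentiableAt u v)
  have h2 := congrArg (fun L : Cn n →L[ℝ] ℝ => L d) h1.fderiv_eq
  rw [fderiv_fun_mul (hasFDerivAt_norm_sq_comp hφ).1 (hre G hGz),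
    fderiv_const_mul (hre _ h.hermitianAt)] at h2
  simp only [add_apply, smul_apply, smul_eq_mul] at h2
  rw [fderiv_re (differentiableAt_herm hGz.differentiableAt u v),
    fderiv_re (differentiableAt_herm h.hermitianAt.differentiableAt u v),
    fderiv_herm hGz.differentiableAt, fderiv_herm h.hermitianAt.differentiableAt] at h2
  rw [herm_eq_sesq] at h2
  linear_combination h2

theorem CoordChangeAt.hessian_hopfPotential (h : CoordChangeAt φ z) (h0 : φ z ≠ 0) (u v : Cn n) :
    ‖φ z‖ ^ 2 * fderiv ℝ (fderiv ℝ (hopfPotential φ)) z u v =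
      2 * (inner ℂ (φ z) (fderiv ℂ (fderiv ℂ φ) z u v)).re +
        2 * (inner ℂ (fderiv ℂ φ z u) (fderiv ℂ φ z v)).re -
        fderiv ℝ (fun w => ‖φ w‖ ^ 2) z u * fderiv ℝ (hopfPotential φ) z v := by
  have hφ := h.contDiff.differentiableAt (by norm_num)
  have hF : DifferentiableAt ℝ (fderiv ℝ (hopfPotential φ)) z :=
    ((contDiffAt_hopfPotential h.contDiff h0).fderiv_right (m := 1)
      (by norm_num)).differentiableAt (by norm_num)
  have hFv := (ContinuousLinearMap.apply ℝ ℝ v).hasFDerivAt.comp z hF.hasFDerivAt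
  have hFv' : HasFDerivAt (fun w => fderiv ℝ (hopfPotential φ) w v) _ z := hFv
  have h1 : (fun w => ‖φ w‖ ^ 2 * fderiv ℝ (hopfPotential φ) w v) =ᶠ[𝓝 z]
      fun w => 2 * (inner ℂ (φ w) (fderiv ℂ φ w v) : ℂ).re := by
    filter_upwards [h.eventually, hφ.continuousAt.eventually_ne h0] with w hw hne
    have hn := norm_pos_iff.2 hne
    rw [fderiv_hopfPotential (hw.contDiff.differentiableAt (by norm_num)) hne]
    field_simp
  have hin : DifferentiableAt ℝ (fun w => (inner ℂ (φ w) (fderiv ℂ φ w v) : ℂ)) z :=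
    (hφ.restrictScalars ℝ).inner ℂ ((h.differentiableAt_fderiv v).restrictScalars ℝ)
  have hre : DifferentiableAt ℝ (fun w => (inner ℂ (φ w) (fderiv ℂ φ w v) : ℂ).re) z :=
    Complex.reCLM.differentiableAt.comp z hin
  have h2 := congrArg (fun L : Cn n →L[ℝ] ℝ => L u) h1.fderiv_eq
  rw [fderiv_fun_mul (hasFDerivAt_norm_sq_comp hφ).1 hFv'.differentiableAt,
    fderiv_const_mul hre] at h2
  simp only [add_apply, smul_apply, smul_eq_mul] at h2
  rw [hFv'.fderiv, fderiv_re hin, fderiv_inner_holomorphic hφ (h.differentiableAt_fderiv v),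
    h.fderiv_fderiv_apply, Complex.add_re] at h2
  have h3 : (ContinuousLinearMap.apply ℝ ℝ v).comp (fderiv ℝ (fderiv ℝ (hopfPotential φ)) z) u =
    fderiv ℝ (fderiv ℝ (hopfPotential φ)) z u v := rfl
  rw [h3] at h2
  linear_combination h2

/-- X is -1/4 of the Euler field in the coordinate φ. After multiplication by |φ|², the D²φ terms on
the two sides agree and the rest is algebra in first derivatives. -/
theorem CoordChangeAt.parallelAt (h : CoordChangeAt φ z) (h0 : φ z ≠ 0) {G : MetricField n}
    (hGz : HermitianAt G z)
    (hG : ∀ᶠ w in 𝓝 z, ∀ i j, G w i j = 4 * flatPullback φ w i j / (‖φ w‖ ^ 2 : ℝ))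
    {X : Cn n} (hX : fderiv ℂ φ z X = -(1 / 4 : ℂ) • φ z) :
    ParallelAt G (hopfPotential φ) z X := by
  have hφ := h.contDiff.differentiableAt (by norm_num)
  have hn := norm_pos_iff.2 h0
  have hGs : ∀ u v, (sesq (G z) u v).re =
      4 * (inner ℂ (fderiv ℂ φ z v) (fderiv ℂ φ z u)).re / ‖φ z‖ ^ 2 := by
    intro u v
    have hs : sesq (G z) u v = ((4 / ‖φ z‖ ^ 2 : ℝ) : ℂ) * sesq (flatPullback φ z) u v := by
      simp only [sesq_apply, hG.self_of_nhds _ _, Finset.mul_sum]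
      refine Finset.sum_congr rfl fun _ _ => Finset.sum_congr rfl fun _ _ => ?_
      push_cast
      ring
    rw [hs, Complex.re_ofReal_mul, sesq_flatPullback]
    ring
  have hsym : ∀ x y : Cn n, (inner ℂ x y : ℂ).re = (inner ℂ y x : ℂ).re := fun x y =>
    inner_re_symm (𝕜 := ℂ) x y
  have hXl : ∀ y, (inner ℂ (fderiv ℂ φ z X) y : ℂ).re = -(1 / 4) * (inner ℂ (φ z) y : ℂ).re := by
    intro y
    have : (starRingEnd ℂ) (-(1 / 4 : ℂ)) = ((-(1 / 4) : ℝ) : ℂ) := by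
      rw [← Complex.conj_ofReal]
      push_cast
      rfl
    rw [hX, inner_smul_left, this, Complex.re_ofReal_mul]
  -- Euler's identity in degree two, with the factor -1/4 of X.
  have hXX : fderiv ℝ (fun w => ‖φ w‖ ^ 2) z X = -(1 / 2) * ‖φ z‖ ^ 2 := by
    have h1 : (inner ℂ (φ z) (φ z) : ℂ).re = ‖φ z‖ ^ 2 := inner_self_eq_norm_sq (𝕜 := ℂ) (φ z)
    rw [(hasFDerivAt_norm_sq_comp hφ).2, hsym, hXl, h1]
    ring
  intro u v
  have e1 := h.sesq_dMat_hopf hGz h0 hG u v X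
  have e2 := h.sesq_dMat_hopf hGz h0 hG v u X
  have e3 := h.sesq_dMat_hopf hGz h0 hG X u v
  have e4 := h.hessian_hopfPotential h0 u v
  rw [hXX] at e3
  rw [(hasFDerivAt_norm_sq_comp hφ).2] at e1 e2 e4
  rw [fderiv_hopfPotential hφ h0] at e4
  simp only [h.sesq_dMat, hGs, Complex.add_re, hXl] at e1 e2 e3
  rw [h.symm X u, h.symm X v, hsym (fderiv ℂ φ z v) (fderiv ℂ (fderiv ℂ φ) z u X),
    hsym (fderiv ℂ φ z v) (fderiv ℂ φ z u)] at e3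
  rw [h.symm v u] at e2
  have hN : ‖φ z‖ ^ 2 ≠ 0 := by positivity
  apply mul_left_cancel₀ hN
  rw [e4]
  simp only [Complex.add_re, Complex.sub_re]
  rw [mul_neg, mul_sub, mul_add, e1, e2, e3]
  field_simp
  ring

end FlatPullback

/-! ### Topology of the Hopf manifold -/

section Hopf

variable {n : ℕ} (α : HopfMultipliers n)

theorem exists_index {z : Cn n} (hz : z ≠ 0) : ∃ i, z i ≠ 0 := by
  by_contra! h
  exact hz (by ext i; simpa using h i)

/-- The graph of the relation is the union over k of the closed sets w = αᵏz. On the k-th set the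
continuous function f, the ratio of log(|w|/|z|) to log|α_i|, equals k, so the family is locally
finite and its union closed. -/
theorem hopf_t2Space : T2Space (Hopf α) := by
  have hq : IsOpenQuotientMap (hopfProj α) :=
    ⟨hopfProj_surjective α, hopfProj_continuous α, hopfProj_isOpenMap α⟩
  rw [t2Space_iff_of_isOpenQuotientMap hq]
  rcases isEmpty_or_nonempty (Fin n) with hn | ⟨⟨i⟩⟩
  · have : IsEmpty (punctured n) := ⟨fun z => z.2 (Subsingleton.elim _ _)⟩
    convert! isClosed_empty
    ext p
    exact this.elim p.1
  have hunion : {q : punctured n × punctured n | hopfProj α q.1 = hopfProj α q.2} =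
      ⋃ k : ℤ, {q : punctured n × punctured n | (q.2 : Cn n) = scale α k q.1} := by
    ext q
    simp only [Set.mem_ofPred_eq, Set.mem_iUnion, hopfProj_eq_iff]
  rw [hunion]
  have hlog : Real.log ‖α.val i‖ ≠ 0 :=
    (Real.log_neg (norm_pos_iff.2 (α.ne_zero i)) (α.norm_lt_one i)).ne
  let f : punctured n × punctured n → ℝ := fun q =>
    (Real.log ‖(q.2 : Cn n)‖ - Real.log ‖(q.1 : Cn n)‖) / Real.log ‖α.val i‖
  have hf : Continuous f := by
    have h1 : Continuous fun z : punctured n => Real.log ‖(z : Cn n)‖ :=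
      Continuous.log (by fun_prop) fun z => norm_ne_zero_iff.2 z.2
    exact ((h1.comp continuous_snd).sub (h1.comp continuous_fst)).div_const _
  have hfk : ∀ (k : ℤ) (q : punctured n × punctured n), (q.2 : Cn n) = scale α k q.1 →
      f q = k := by
    intro k q hq
    have h1 : ‖α.val i‖ ^ k ≠ 0 := zpow_ne_zero k (norm_ne_zero_iff.2 (α.ne_zero i))
    simp only [f, hq, norm_scale α i]
    rw [Real.log_mul h1 (norm_ne_zero_iff.2 q.1.2), Real.log_zpow]
    field_simp
    ring
  refine LocallyFinite.isClosed_iUnion (fun p => ?_) fun k => ?_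
  · refine ⟨f ⁻¹' Metric.ball (f p) 1, hf.continuousAt.preimage_mem_nhds
      (Metric.ball_mem_nhds _ one_pos), (Set.finite_Icc ⌊f p - 1⌋ ⌈f p + 1⌉).subset ?_⟩
    rintro k ⟨q, hq, hqk⟩
    have h1 := hqk
    rw [Set.mem_preimage, hfk k q hq, Metric.mem_ball, Real.dist_eq, abs_lt] at h1
    constructor
    · exact_mod_cast (Int.floor_le (f p - 1)).trans (by linarith [h1.1] : f p - 1 ≤ (k : ℝ))
    · exact_mod_cast (by linarith [h1.2] : (k : ℝ) ≤ f p + 1).trans (Int.le_ceil (f p + 1))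
  · exact isClosed_eq (by fun_prop)
      ((scale_contDiff α k).continuous.comp (continuous_subtype_val.comp continuous_fst))

/-- The compact annulus ρ ≤ |z| ≤ 1 meets every orbit. -/
theorem hopf_compactSpace : CompactSpace (Hopf α) := by
  rcases isEmpty_or_nonempty (Fin n) with hn | ⟨⟨i⟩⟩
  · have : IsEmpty (punctured n) := ⟨fun z => z.2 (Subsingleton.elim _ _)⟩
    have : IsEmpty (Hopf α) := ⟨fun x => by
      obtain ⟨z, -⟩ := hopfProj_surjective α x
      exact this.elim z⟩
    infer_instance
  set ρ := ‖α.val i‖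
  have hρ0 : 0 < ρ := norm_pos_iff.2 (α.ne_zero i)
  have hρ1 : ρ < 1 := α.norm_lt_one i
  let K : Set (punctured n) := {z | ρ ≤ ‖(z : Cn n)‖ ∧ ‖(z : Cn n)‖ ≤ 1}
  have hK : IsCompact K := by
    rw [Subtype.isCompact_iff]
    have h1 : Subtype.val '' K = Metric.closedBall (0 : Cn n) 1 ∩ {z | ρ ≤ ‖z‖} := by
      ext z
      simp only [Set.mem_image, Set.mem_inter_iff, mem_closedBall_zero_iff, Set.mem_ofPred_eq]
      constructor
      · rintro ⟨w, ⟨h1, h2⟩, rfl⟩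
        exact ⟨h2, h1⟩
      · rintro ⟨h1, h2⟩
        exact ⟨⟨z, norm_pos_iff.1 (hρ0.trans_le h2)⟩, ⟨h2, h1⟩, rfl⟩
    rw [h1]
    exact (isCompact_closedBall _ _).inter_right (isClosed_le continuous_const continuous_norm)
  have h2 : hopfProj α '' K = Set.univ := by
    refine Set.eq_univ_of_forall fun x => ?_
    obtain ⟨z, rfl⟩ := hopfProj_surjective α x
    -- Here ρ^{-m} ≤ |z| < ρ^{-(m+1)}, so the power m + 1 of the contraction brings |z| into [ρ, 1).
    obtain ⟨m, hm1, hm2⟩ := exists_mem_Ico_zpow (norm_pos_iff.2 z.2)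
      ((one_lt_inv₀ hρ0).2 hρ1)
    refine ⟨⟨scale α (m + 1) z, scale_ne_zero α _ z.2⟩, ?_,
      ((hopfProj_eq_iff α _ _).2 ⟨m + 1, rfl⟩).symm⟩
    change ρ ≤ ‖scale α (m + 1) z‖ ∧ ‖scale α (m + 1) z‖ ≤ 1
    rw [norm_scale α i]
    change ρ ≤ ρ ^ (m + 1) * _ ∧ ρ ^ (m + 1) * _ ≤ 1
    rw [inv_zpow] at hm1 hm2
    have h3 : 0 < ρ ^ m := zpow_pos hρ0 m
    have h4 : 0 < ρ ^ (m + 1) := zpow_pos hρ0 _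
    constructor
    · calc ρ = ρ ^ (m + 1) * (ρ ^ m)⁻¹ := by rw [zpow_add_one₀ hρ0.ne']; field_simp
        _ ≤ _ := mul_le_mul_of_nonneg_left hm1 h4.le
    · calc _ ≤ ρ ^ (m + 1) * (ρ ^ (m + 1))⁻¹ := mul_le_mul_of_nonneg_left hm2.le h4.le
        _ = 1 := mul_inv_cancel₀ h4.ne'
  exact ⟨h2 ▸ hK.image (hopfProj_continuous α)⟩

/-! ### The Hopf metric -/

/-- `scale α k` as a continuous linear map. -/
noncomputable def scaleL (k : ℤ) : Cn n →L[ℂ] Cn n :=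
  LinearMap.toContinuousLinearMap
    { toFun := scale α k
      map_add' := fun u v => by ext i; simp [scale, mul_add]
      map_smul' := fun c u => by ext i; simp [scale, mul_left_comm] }

/-- Equality of the moduli makes αᵏ a homothety of the flat Hermitian form. -/
theorem inner_scale (i : Fin n) (k : ℤ) (u v : Cn n) :
    inner ℂ (scale α k u) (scale α k v) = ((‖α.val i‖ ^ k) ^ 2 : ℝ) * inner ℂ u v := by
  rw [PiLp.inner_apply, PiLp.inner_apply, Finset.mul_sum]
  refine Finset.sum_congr rfl fun j _ => ?_
  have h : α.val j ^ k * conj (α.val j ^ k) = ((‖α.val i‖ ^ k) ^ 2 : ℝ) := by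
    rw [Complex.mul_conj, Complex.normSq_eq_norm_sq, norm_zpow, α.norm_eq j i]
  rw [← h]
  simp only [scale, RCLike.inner_apply, map_mul]
  ring

/-- The coordinates of `x` in the preferred chart at `x`. -/
noncomputable def basePoint (x : Hopf α) : Cn n := chartAt (Cn n) x x

theorem hopfProj_basePoint (x : Hopf α) :
    ∃ h : basePoint α x ∈ punctured n, x = hopfProj α ⟨basePoint α x, h⟩ := by
  obtain ⟨h, h'⟩ := hopf_chart_symm α (chart_mem_atlas (Cn n) x)
    ((chartAt (Cn n) x).map_source (mem_chart_source (Cn n) x))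
  exact ⟨h, ((chartAt (Cn n) x).left_inv (mem_chart_source (Cn n) x)).symm.trans h'⟩

theorem hasMFDerivAt_chart_symm {M : Type*} [TopologicalSpace M] [ChartedSpace (Cn n) M]
    [IsManifold 𝓘(ℂ, Cn n) ω M] (x : M) :
    HasMFDerivAt 𝓘(ℂ, Cn n) 𝓘(ℂ, Cn n) (chartAt (Cn n) x).symm (chartAt (Cn n) x x)
      (ContinuousLinearMap.id ℂ (Cn n)) := by
  have : IsManifold 𝓘(ℂ, Cn n) 1 M := IsManifold.of_le (n := ω) le_top
  have h1 := (mdifferentiableAt_atlas_symm (I := 𝓘(ℂ, Cn n)) (chart_mem_atlas (Cn n) x)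
    ((chartAt (Cn n) x).map_source (mem_chart_source (Cn n) x))).hasMFDerivAt
  have h2 := mfderivWithin_range_extChartAt_symm (I := 𝓘(ℂ, Cn n)) (x := x)
  rw [ModelWithCorners.range_eq_univ, mfderivWithin_univ] at h2
  have h3 : mfderiv 𝓘(ℂ, Cn n) 𝓘(ℂ, Cn n) (chartAt (Cn n) x).symm (chartAt (Cn n) x x) =
    ContinuousLinearMap.id ℂ (Cn n) := h2
  rwa [h3] at h1

/-- The tangent space at ψ x is read in the preferred chart there, whose base point may differ from
the lift φ x by some αᵏ; the derivative acquires exactly this linear factor. -/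
theorem hasMFDerivAt_of_lift {X : Type*} [TopologicalSpace X] [ChartedSpace (Cn n) X]
    {ψ : X → Hopf α} {φ : X → Cn n} {x : X} {φ' : Cn n →L[ℂ] Cn n}
    (hφ : HasMFDerivAt 𝓘(ℂ, Cn n) 𝓘(ℂ, Cn n) φ x φ')
    (h : ∀ᶠ y in 𝓝 x, ∃ h : φ y ∈ punctured n, ψ y = hopfProj α ⟨φ y, h⟩) :
    ∃ k : ℤ, basePoint α (ψ x) = scale α k (φ x) ∧
      HasMFDerivAt 𝓘(ℂ, Cn n) 𝓘(ℂ, Cn n) ψ x ((scaleL α k).comp φ') := by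
  obtain ⟨h0, h1⟩ := h.self_of_nhds
  obtain ⟨h2, h3⟩ := hopfProj_basePoint α (ψ x)
  obtain ⟨k, hk⟩ := (hopfProj_eq_iff α _ _).1 (h1.symm.trans h3)
  refine ⟨k, hk, ?_⟩
  set c := chartAt (Cn n) (ψ x) with hc
  have hk' : c (ψ x) = scale α k (φ x) := hk
  have hct : scale α k (φ x) ∈ c.target := hk' ▸ c.map_source (mem_chart_source (Cn n) (ψ x))
  have hs : HasMFDerivAt 𝓘(ℂ, Cn n) 𝓘(ℂ, Cn n) (scale α k) (φ x) (scaleL α k) :=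
    (scaleL α k).hasFDerivAt.hasMFDerivAt
  have hcs : HasMFDerivAt 𝓘(ℂ, Cn n) 𝓘(ℂ, Cn n) c.symm (scale α k (φ x))
      (ContinuousLinearMap.id ℂ (Cn n)) := by
    rw [← hk']
    exact hasMFDerivAt_chart_symm (ψ x)
  refine (hcs.comp x (hs.comp x hφ)).congr_of_eventuallyEq ?_
  have h6 : ∀ᶠ y in 𝓝 x, scale α k (φ y) ∈ c.target :=
    ((scale_contDiff α k).continuous.continuousAt.comp hφ.1).preimage_mem_nhds
      (c.open_target.mem_nhds hct)
  filter_upwards [h, h6] with y ⟨h7, h8⟩ h9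
  obtain ⟨h10, h11⟩ := hopf_chart_symm α (chart_mem_atlas (Cn n) (ψ x)) h9
  rw [h8]
  exact ((hopfProj_eq_iff α _ _).2 ⟨k, rfl⟩).trans h11.symm

/-- The Hopf metric at `x`, in the preferred chart at `x`. -/
noncomputable def hopfForm (x : Hopf α) : Cn n →ₗ[ℂ] Cn n →ₗ⋆[ℂ] ℂ :=
  ((4 / ‖basePoint α x‖ ^ 2 : ℝ) : ℂ) • (innerₛₗ ℂ).flip

theorem hopfForm_apply (x : Hopf α) (u v : Cn n) :
    hopfForm α x u v = ((4 / ‖basePoint α x‖ ^ 2 : ℝ) : ℂ) * inner ℂ v u := rfl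

theorem hopfForm_conj (x : Hopf α) (u v : Cn n) :
    conj (hopfForm α x u v) = hopfForm α x v u := by
  rw [hopfForm_apply, hopfForm_apply, map_mul, Complex.conj_ofReal, inner_conj_symm]

theorem hopfForm_pos (x : Hopf α) {u : Cn n} (hu : u ≠ 0) : 0 < (hopfForm α x u u).re := by
  have h1 : 0 < ‖basePoint α x‖ := norm_pos_iff.2 (hopfProj_basePoint α x).1
  have h2 : (inner ℂ u u : ℂ).re = ‖u‖ ^ 2 := inner_self_eq_norm_sq (𝕜 := ℂ) u
  have h3 : 0 < ‖u‖ := norm_pos_iff.2 hu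
  rw [hopfForm_apply, Complex.re_ofReal_mul, h2]
  positivity

/-- The Lee form of the Hopf metric at `x`, in the preferred chart at `x`. -/
noncomputable def hopfLeeForm (x : Hopf α) : Cn n →ₗ[ℝ] ℝ where
  toFun u := -(2 / ‖basePoint α x‖ ^ 2) * (inner ℂ (basePoint α x) u).re
  map_add' u v := by rw [inner_add_right, Complex.add_re, mul_add]
  map_smul' r u := by
    rw [← Complex.coe_smul, inner_smul_right, Complex.re_ofReal_mul, RingHom.id_apply,
      smul_eq_mul]
    ring

/-- The factors |α_i|^{2k} from the inner product and from |p|² cancel, so the form can be computed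
at any representative p of x. -/
theorem hopfForm_lift {x : Hopf α} {p : Cn n} (hp : p ≠ 0) {k : ℤ}
    (hk : basePoint α x = scale α k p) (u v : Cn n) :
    hopfForm α x (scale α k u) (scale α k v) = 4 * inner ℂ v u / (‖p‖ ^ 2 : ℝ) := by
  obtain ⟨i, -⟩ := exists_index hp
  have h1 : ‖α.val i‖ ^ k ≠ 0 := zpow_ne_zero k (norm_ne_zero_iff.2 (α.ne_zero i))
  have h2 := norm_ne_zero_iff.2 hp
  have h3 : 4 / (‖α.val i‖ ^ k * ‖p‖) ^ 2 * (‖α.val i‖ ^ k) ^ 2 = 4 / ‖p‖ ^ 2 := by field_simp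
  rw [hopfForm_apply, hk, inner_scale α i, norm_scale α i, ← mul_assoc, ← Complex.ofReal_mul, h3]
  push_cast
  ring

theorem hopfLeeForm_lift {x : Hopf α} {p : Cn n} (hp : p ≠ 0) {k : ℤ}
    (hk : basePoint α x = scale α k p) (u : Cn n) :
    hopfLeeForm α x (scale α k u) = -(2 * (inner ℂ p u).re / ‖p‖ ^ 2) := by
  obtain ⟨i, -⟩ := exists_index hp
  have h1 : ‖α.val i‖ ^ k ≠ 0 := zpow_ne_zero k (norm_ne_zero_iff.2 (α.ne_zero i))
  have h2 := norm_ne_zero_iff.2 hp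
  change -(2 / ‖basePoint α x‖ ^ 2) * (inner ℂ (basePoint α x) (scale α k u)).re = _
  rw [hk, inner_scale α i, norm_scale α i, Complex.re_ofReal_mul]
  field_simp

/-- Every holomorphic chart of the Hopf manifold lifts locally to `ℂⁿ ∖ {0}`. -/
theorem exists_chart_lift {e : OpenPartialHomeomorph (Hopf α) (Cn n)}
    (he : e ∈ holoCharts n (Hopf α)) {z : Cn n} (hz : z ∈ e.target) :
    ∃ φ : Cn n → Cn n, CoordChangeAt φ z ∧ φ z ≠ 0 ∧ ContDiffAt ℂ ω φ z ∧
      ∀ᶠ w in 𝓝 z,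
        (∀ u v, hopfForm α (e.symm w) (tangentOf e w u) (tangentOf e w v) =
          4 * inner ℂ (fderiv ℂ φ w v) (fderiv ℂ φ w u) / (‖φ w‖ ^ 2 : ℝ)) ∧
        ∀ u, hopfLeeForm α (e.symm w) (tangentOf e w u) =
          -(2 * (inner ℂ (φ w) (fderiv ℂ φ w u)).re / ‖φ w‖ ^ 2) := by
  set c := chartAt (Cn n) (e.symm z) with hc
  have hcc : c ∈ holoCharts n (Hopf α) := IsManifold.chart_mem_maximalAtlas _
  have hsrc : e.symm z ∈ c.source := mem_chart_source (Cn n) (e.symm z)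
  have hU : ∀ᶠ w in 𝓝 z, w ∈ e.target ∧ e.symm w ∈ c.source :=
    (e.open_target.eventually_mem hz).and
      ((e.continuousAt_symm hz).preimage_mem_nhds (c.open_source.mem_nhds hsrc))
  have hlift : ∀ w, w ∈ e.target ∧ e.symm w ∈ c.source →
      ∃ h : c (e.symm w) ∈ punctured n, e.symm w = hopfProj α ⟨c (e.symm w), h⟩ := by
    rintro w ⟨-, hw⟩
    obtain ⟨h, h'⟩ := hopf_chart_symm α (chart_mem_atlas (Cn n) (e.symm z)) (c.map_source hw)
    exact ⟨h, (c.left_inv hw).symm.trans h'⟩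
  have hsm : ∀ w, w ∈ e.target ∧ e.symm w ∈ c.source →
      ContDiffAt ℂ ω (fun w => c (e.symm w)) w := fun w hw =>
    ((contMDiffAt_of_mem_maximalAtlas hcc hw.2).comp w
      (contMDiffAt_symm_of_mem_maximalAtlas he hw.1)).contDiffAt
  -- The exponent k may jump with w, because preferred charts at nearby points are unrelated. The
  -- invariance of the two forms removes it, leaving expressions smooth in w.
  have hder : ∀ᶠ w in 𝓝 z, ∃ k : ℤ, basePoint α (e.symm w) = scale α k (c (e.symm w)) ∧
      ∀ u, tangentOf e w u = scale α k (fderiv ℂ (fun w => c (e.symm w)) w u) := by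
    filter_upwards [hU.eventually_nhds] with w hw
    have h1 := ((hsm w hw.self_of_nhds).differentiableAt (by simp)).hasFDerivAt.hasMFDerivAt
    obtain ⟨k, hk, hk'⟩ := hasMFDerivAt_of_lift α (ψ := e.symm) h1 (hw.mono hlift)
    refine ⟨k, hk, fun u => ?_⟩
    exact congrArg (fun L : Cn n →L[ℂ] Cn n => L u) hk'.mfderiv
  refine ⟨fun w => c (e.symm w), ⟨(hsm z hU.self_of_nhds).of_le (by simp), ?_⟩,
    (hlift z hU.self_of_nhds).1, hsm z hU.self_of_nhds, ?_⟩
  · filter_upwards [hU, hder] with w hw ⟨k, hk, hk'⟩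
    refine (injective_iff_map_eq_zero _).2 fun u hu => ?_
    by_contra hu0
    refine tangentOf_ne_zero he hw.1 hu0 ((hk' u).trans ?_)
    rw [hu]
    exact (scaleL α k).map_zero
  · filter_upwards [hU, hder] with w hw ⟨k, hk, hk'⟩
    have h0 : c (e.symm w) ≠ 0 := (hlift w hw).1
    refine ⟨fun u v => ?_, fun u => ?_⟩
    · rw [hk', hk']
      exact hopfForm_lift α h0 hk _ _
    · rw [hk']
      exact hopfLeeForm_lift α h0 hk _

/-- The Hopf metric `4 √-1 ∂∂̄|z|² / |z|²`. -/
noncomputable def hopfMetric : HermitianMetric n (Hopf α) where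
  form x := hopfForm α x
  conj_symm x u v := by
    exact hopfForm_conj α x u v
  pos x u hu := by
    exact hopfForm_pos α x hu
  smooth e he i j z hz := by
    obtain ⟨φ, hφ, h0, hφs, h⟩ := exists_chart_lift α he hz
    refine ContDiffAt.contDiffWithinAt (ContDiffAt.congr_of_eventuallyEq ?_
      (h.mono fun w hw => hw.1 _ _))
    have h1 : ContDiffAt ℝ ∞ φ z := (hφs.restrict_scalars ℝ).of_le le_top
    have h2 : ∀ u, ContDiffAt ℝ ∞ (fun w => fderiv ℂ φ w u) z := fun u =>
      ((ContinuousLinearMap.apply ℂ (Cn n) u).contDiff.contDiffAt.comp z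
        (hφs.fderiv_right (m := ∞) le_top)).restrict_scalars ℝ
    have h3 : ContDiffAt ℝ ∞ (fun w => ((‖φ w‖ ^ 2 : ℝ) : ℂ)) z :=
      Complex.ofRealCLM.contDiff.contDiffAt.comp z (h1.norm_sq ℂ)
    simp_rw [div_eq_mul_inv]
    exact (contDiffAt_const.mul ((h2 _).inner ℂ (h2 _))).mul (h3.inv <| Complex.ofReal_ne_zero.2 (pow_ne_zero 2 (norm_ne_zero_iff.2 h0)))

/-- The Lee form of the Hopf metric. -/
noncomputable def hopfLee : RealOneForm n (Hopf α) where
  form x := hopfLeeForm α x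
  smooth e he a z hz := by
    obtain ⟨φ, hφ, h0, hφs, h⟩ := exists_chart_lift α he hz
    refine ContDiffAt.contDiffWithinAt (ContDiffAt.congr_of_eventuallyEq ?_
      (h.mono fun w hw => hw.2 _))
    have h1 : ContDiffAt ℝ ∞ φ z := (hφs.restrict_scalars ℝ).of_le le_top
    have h2 : ∀ u, ContDiffAt ℝ ∞ (fun w => fderiv ℂ φ w u) z := fun u =>
      ((ContinuousLinearMap.apply ℂ (Cn n) u).contDiff.contDiffAt.comp z
        (hφs.fderiv_right (m := ∞) le_top)).restrict_scalars ℝ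
    exact ((contDiffAt_const.mul (Complex.reCLM.contDiff.contDiffAt.comp z (h1.inner ℂ (h2 _)))).div
      (h1.norm_sq ℂ) (pow_ne_zero 2 (norm_ne_zero_iff.2 h0))).neg

theorem hopfMetric_hopfProj (z : punctured n) (u v : Cn n) :
    (hopfMetric α).form (hopfProj α z)
      (mfderiv 𝓘(ℂ, Cn n) 𝓘(ℂ, Cn n) (hopfProj α) z u)
      (mfderiv 𝓘(ℂ, Cn n) 𝓘(ℂ, Cn n) (hopfProj α) z v) =
    4 * (∑ i, u i * conj (v i)) / (‖(z : Cn n)‖ ^ 2 : ℝ) := by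
  -- The inclusion is itself a lift of the projection, and the chart of an open subset is its
  -- restriction, so the derivative is the identity.
  have hval : HasMFDerivAt 𝓘(ℂ, Cn n) 𝓘(ℂ, Cn n) (Subtype.val : punctured n → Cn n) z
      (ContinuousLinearMap.id ℂ (Cn n)) := by
    refine ⟨continuous_subtype_val.continuousAt, ?_⟩
    have h := TopologicalSpace.Opens.chartAt_subtype_val_symm_eventuallyEq (H := Cn n)
      (punctured n) (x := z)
    refine HasFDerivWithinAt.congr_of_eventuallyEq (hasFDerivWithinAt_id _ _)
      (Filter.EventuallyEq.filter_mono h.symm nhdsWithin_le_nhds) h.symm.self_of_nhds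
  obtain ⟨k, hk, hk'⟩ := hasMFDerivAt_of_lift α (ψ := hopfProj α) hval
    (Filter.Eventually.of_forall fun y => ⟨y.2, rfl⟩)
  rw [hk'.mfderiv]
  refine (hopfForm_lift α z.2 hk u v).trans ?_
  rw [PiLp.inner_apply]
  rfl

theorem hopfMetric_coord {e : OpenPartialHomeomorph (Hopf α) (Cn n)} {φ : Cn n → Cn n} {z : Cn n}
    (h : ∀ᶠ w in 𝓝 z,
      (∀ u v, hopfForm α (e.symm w) (tangentOf e w u) (tangentOf e w v) =
        4 * inner ℂ (fderiv ℂ φ w v) (fderiv ℂ φ w u) / (‖φ w‖ ^ 2 : ℝ)) ∧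
      ∀ u, hopfLeeForm α (e.symm w) (tangentOf e w u) =
        -(2 * (inner ℂ (φ w) (fderiv ℂ φ w u)).re / ‖φ w‖ ^ 2)) :
    ∀ᶠ w in 𝓝 z, ∀ i j, (hopfMetric α).coord e w i j =
      4 * flatPullback φ w i j / (‖φ w‖ ^ 2 : ℝ) :=
  h.mono fun _ hw i j => hw.1 (unitVec i) (unitVec j)

theorem conformal_hopf {φ : Cn n → Cn n} {z : Cn n} (hφ : ContinuousAt φ z) (h0 : φ z ≠ 0)
    {G : MetricField n}
    (hG : ∀ᶠ w in 𝓝 z, ∀ i j, G w i j = 4 * flatPullback φ w i j / (‖φ w‖ ^ 2 : ℝ)) :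
    ∀ᶠ w in 𝓝 z, ∀ i j, flatPullback φ w i j = Real.exp (hopfPotential φ w) * G w i j := by
  filter_upwards [hG, hφ.eventually_ne h0] with w hw hne i j
  have hn : ((‖φ w‖ : ℝ) : ℂ) ≠ 0 := Complex.ofReal_ne_zero.2 (norm_ne_zero_iff.2 hne)
  rw [hw, exp_hopfPotential hne]
  push_cast
  field_simp

theorem hopf_vaisman : IsLeeForm (hopfMetric α) (hopfLee α) ∧
    IsParallel (hopfMetric α) (hopfLee α) := by
  have main : ∀ e ∈ holoCharts n (Hopf α), ∀ z ∈ e.target,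
      ((∀ a b, dCovector ((hopfLee α).coord e) z a b = 0) ∧
        ∀ a b c, dFundForm ((hopfMetric α).coord e) z a b c =
          wedgeFund ((hopfLee α).coord e) ((hopfMetric α).coord e) z a b c) ∧
      ∀ a b, nablaCovector ((hopfMetric α).coord e) ((hopfLee α).coord e) z a b = 0 := by
    intro e he z hz
    obtain ⟨φ, hφ, h0, -, h⟩ := exists_chart_lift α he hz
    have hG := (hopfMetric α).hermitianAt_coord he hz
    have hφd := hφ.contDiff.differentiableAt (by norm_num)
    have hθ : ∀ᶠ w in 𝓝 z, ∀ u, hopfLeeForm α (e.symm w) (tangentOf e w u) =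
        -fderiv ℝ (hopfPotential φ) w u := by
      filter_upwards [h, hφ.eventually, hφd.continuousAt.eventually_ne h0] with w hw hφw hne u
      rw [fderiv_hopfPotential (hφw.contDiff.differentiableAt (by norm_num)) hne]
      exact hw.2 u
    have hθ' : ∀ᶠ w in 𝓝 z, ∀ a, (hopfLee α).coord e w a =
        -fderiv ℝ (hopfPotential φ) w (realVec a) := hθ.mono fun w hw a => hw _
    have hF := contDiffAt_hopfPotential hφ.contDiff h0
    have hFd : DifferentiableAt ℝ (fderiv ℝ (hopfPotential φ)) z :=
      (hF.fderiv_right (m := 1) (by norm_num)).differentiableAt (by norm_num)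
    have hcoord := hopfMetric_coord α h
    refine ⟨⟨fun a b => ?_, ?_⟩, ?_⟩
    · have hd : ∀ a b, dR a (fun w => (hopfLee α).coord e w b) z =
          -fderiv ℝ (fderiv ℝ (hopfPotential φ)) z (realVec a) (realVec b) := by
        intro a b
        have h1 : HasFDerivAt (fun w => -fderiv ℝ (hopfPotential φ) w (realVec b))
            (-(ContinuousLinearMap.apply ℝ ℝ (realVec b)).comp
              (fderiv ℝ (fderiv ℝ (hopfPotential φ)) z)) z :=
          ((ContinuousLinearMap.apply ℝ ℝ (realVec b)).hasFDerivAt.comp z hFd.hasFDerivAt).neg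
        rw [dR, Filter.EventuallyEq.fderiv_eq (hθ'.mono fun w hw => hw b), h1.fderiv]
        rfl
      have hs : fderiv ℝ (fderiv ℝ (hopfPotential φ)) z (realVec a) (realVec b) =
          fderiv ℝ (fderiv ℝ (hopfPotential φ)) z (realVec b) (realVec a) :=
        hF.isSymmSndFDerivAt (by simp) _ _
      rw [dCovector, hd, hd, hs, sub_self]
    · refine (leeAt_iff hG.differentiableAt
        (l := -(fderiv ℝ (hopfPotential φ) z : Cn n →ₗ[ℝ] ℝ)) hθ'.self_of_nhds).2 ?_
      refine hφ.leeAt_zero.of_conformal hG.differentiableAt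
        (hF.differentiableAt (by norm_num)) ?_
      exact conformal_hopf hφd.continuousAt h0 hcoord
    -- The injective differential of φ is bijective by dimension, so the multiple -1/4 of the Euler
    -- field can be pulled back.
    · obtain ⟨X, hX⟩ := LinearMap.surjective_of_injective
        (f := (fderiv ℂ φ z : Cn n →ₗ[ℂ] Cn n)) hφ.injective.self_of_nhds (-(1 / 4 : ℂ) • φ z)
      have hX : fderiv ℂ φ z X = -(1 / 4 : ℂ) • φ z := hX
      refine (parallelAt_iff hG.differentiableAt hG.pos.self_of_nhds hFd hθ' (X := X)
        fun d => ?_).2 (hφ.parallelAt h0 hG hcoord hX)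
      rw [HermitianMetric.sesq_coord, fderiv_hopfPotential hφd h0]
      have h1 : (hopfMetric α).form (e.symm z) (tangentOf e z X) (tangentOf e z d) = _ :=
        h.self_of_nhds.1 X d
      have h2 : (4 * inner ℂ (fderiv ℂ φ z d) (-(1 / 4 : ℂ) • φ z) / (‖φ z‖ ^ 2 : ℝ) : ℂ) =
          ((-(1 / ‖φ z‖ ^ 2) : ℝ) : ℂ) * inner ℂ (fderiv ℂ φ z d) (φ z) := by
        rw [inner_smul_right]
        push_cast
        ring
      have h3 : (inner ℂ (fderiv ℂ φ z d) (φ z) : ℂ).re = (inner ℂ (φ z) (fderiv ℂ φ z d)).re :=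
        inner_re_symm (𝕜 := ℂ) _ _
      rw [h1, hX, h2, Complex.re_ofReal_mul, h3]
      ring
  exact ⟨fun e he z hz => (main e he z hz).1, fun e he z hz => (main e he z hz).2⟩

theorem hopf_qNonneg : QNonneg (hopfMetric α) := by
  intro e he z hz ε hε lam
  rcases lt_or_ge n 2 with hn | hn
  · refine Finset.sum_nonneg fun k _ => Finset.sum_nonneg fun m _ => ?_
    obtain rfl : k = m := Fin.ext (by omega)
    exact le_of_eq (by ring)
  obtain ⟨φ, hφ, h0, -, h⟩ := exists_chart_lift α he hz
  obtain ⟨hL, hP⟩ := hopf_vaisman α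
  refine tensorQ_sum_nonneg_of_leeForm hn ((hopfMetric α).hermitianAt_coord he hz)
    hφ.hermitianAt (F := hopfPotential φ) ?_ (l := (hopfLee α).coordLinear e)
    (fun _ _ => rfl) ?_ (hP e he z hz) (hφ.eventually.mono fun w hw => hw.leeAt_zero) ?_ hε lam
  · exact conformal_hopf (hφ.contDiff.differentiableAt (by norm_num)).continuousAt h0
      (hopfMetric_coord α h)
  · filter_upwards [e.open_target.mem_nhds hz] with w hw
    exact HermitianMetric.leeAt_coord hL he hw
  -- The comparison metric is flat, so the curvature hypothesis reads 0 ≤ 0.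
  · intro ε _ lam
    simp [evalDiag, hφ.chernCurv_eq_zero]

end Hopf

end QPositivity

theorem mainTheorem5 :
    (∀ (n : ℕ) (M : Type*) [TopologicalSpace M] [T2Space M] [CompactSpace M]
        [ChartedSpace (Cn n) M] [IsManifold 𝓘(ℂ, Cn n) ω M]
        (N : Type*) [TopologicalSpace N] [ChartedSpace (Cn n) N] [IsManifold 𝓘(ℂ, Cn n) ω N]
        (π : N → M) (g : HermitianMetric n M) (g' : HermitianMetric n N),
        IsVaisman g → IsKahlerCover π g g' → NonnegQuadOrthBisectional g' → QNonneg g) ∧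
    (∀ (n : ℕ) (α : HopfMultipliers n),
        T2Space (Hopf α) ∧ CompactSpace (Hopf α) ∧
        ∃ g : HermitianMetric n (Hopf α),
          (∀ (z : punctured n) (u v : Cn n),
            g.form (hopfProj α z)
                (mfderiv 𝓘(ℂ, Cn n) 𝓘(ℂ, Cn n) (hopfProj α) z u)
                (mfderiv 𝓘(ℂ, Cn n) 𝓘(ℂ, Cn n) (hopfProj α) z v) =
              4 * (∑ i, u i * conj (v i)) / (‖(z : Cn n)‖ ^ 2 : ℝ)) ∧
          IsVaisman g ∧ QNonneg g) := by
  refine ⟨?_, fun n α => ⟨hopf_t2Space α, hopf_compactSpace α, hopfMetric α,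
    hopfMetric_hopfProj α, ⟨hopfLee α, hopf_vaisman α⟩, hopf_qNonneg α⟩⟩
  intro n M _ _ _ _ _ N _ _ _ π g g' hV hC hR
  exact qNonneg_of_kahlerCover hV hC hR
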